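/- For a prime $p$, let $\mathcal K_p$ be the set of integers $k$ with $2\le k\le p-2$ and $\gcd(k,p-1)=1$. For $k\in\mathcal K_p$ and $a\in(\mathbb Z/p\mathbb Z)^\times$, let $\eta_{a,k}$ be the permutation $s\mapsto as^k$ of $\mathbb Z/p\mathbb Z$. For a permutation $\sigma$ of $\mathbb Z/n\mathbb Z$, define its discrepancy by $$D(\sigma)=\max_{I,J}\left|\,|\sigma(I)\cap J|-\frac{|I||J|}{n}\right|,$$ where $I,J$ range over all intervals of $\mathbb Z/n\mathbb Z$, i.e. images of intervals of $\mathbb Z$ under reduction modulo $n$. Theorem. For almost all $k\in\mathcal K_p$ one has $D(\eta_{a,k})\ll p^{11/12}\log\log p$, uniformly in $a$ and $k$. That is, there is an absolute constant $C>0$ such that for every $\varepsilon>0$ and all sufficiently large primes $p$ (depending on $\varepsilon$), all but at most $\varepsilon|\mathcal K_p|$ of the exponents $k\in\mathcal K_p$ satisfy $$D(\eta_{a,k})\le C\,p^{11/12}\log\log p\qquad\text{for all } a\in(\mathbb Z/p\mathbb Z)^\times .$$ -/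

import Mathlib

/-- An interval of `ℤ/nℤ`: the image under reduction modulo `n` of an interval of `ℤ`
(wrap-around is permitted). -/
def IsModInterval {n : ℕ} (S : Set (ZMod n)) : Prop :=
  ∃ I : Set ℤ, I.OrdConnected ∧ S = (fun x : ℤ => (x : ZMod n)) '' I

/-- The discrepancy `D_T(S) = | |S ∩ T| - |S||T|/n |` of `S` in `T`, for subsets of `ℤ/nℤ`. -/
noncomputable def setDiscrepancy {n : ℕ} (T S : Set (ZMod n)) : ℝ :=
  |((S ∩ T).ncard : ℝ) - (S.ncard : ℝ) * (T.ncard : ℝ) / (n : ℝ)|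

/-- The numbers `D_J(σ(I))`, where `I` and `J` vary over all intervals of `ℤ/nℤ`. -/
def intervalDiscrepancies {n : ℕ} (σ : Equiv.Perm (ZMod n)) : Set ℝ :=
  {d | ∃ I J : Set (ZMod n), IsModInterval I ∧ IsModInterval J ∧ d = setDiscrepancy J (σ '' I)}

/-- The discrepancy `D(σ) = max_{I,J} D_J(σ(I))` of a permutation `σ` of `ℤ/nℤ`. -/
noncomputable def permDiscrepancy {n : ℕ} (σ : Equiv.Perm (ZMod n)) : ℝ :=
  sSup (intervalDiscrepancies σ)

/-- For `n ≠ 0` the supremum in the definition of the discrepancy is a maximum. -/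
theorem permDiscrepancy_isGreatest {n : ℕ} [NeZero n] (σ : Equiv.Perm (ZMod n)) :
    IsGreatest (intervalDiscrepancies σ) (permDiscrepancy σ) := by
  have hfin : (intervalDiscrepancies σ).Finite := by
    refine (Set.finite_range (fun q : Set (ZMod n) × Set (ZMod n) =>
      setDiscrepancy q.2 (σ '' q.1))).subset ?_
    rintro d ⟨I, J, -, -, rfl⟩
    exact ⟨(I, J), rfl⟩
  have hne : (intervalDiscrepancies σ).Nonempty :=
    ⟨_, ∅, ∅, ⟨∅, Set.ordConnected_empty, by simp⟩, ⟨∅, Set.ordConnected_empty, by simp⟩, rfl⟩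
  exact ⟨hne.csSup_mem hfin, fun d hd => le_csSup hfin.bddAbove hd⟩

/-- The exponents `2 ≤ k ≤ p - 2` with `(k, p - 1) = 1`; these are the classes of `ℤ/(p-1)ℤ`
coprime to `p - 1`, represented in `{0, …, p - 2}`, with `k ≥ 2`. -/
def powerExponents (p : ℕ) : Finset ℕ :=
  (Finset.Ico 2 (p - 1)).filter (fun k => Nat.Coprime k (p - 1))

theorem powerMap_bijective (p : ℕ) [Fact p.Prime] (a : (ZMod p)ˣ) (k : powerExponents p) :
    Function.Bijective (fun s : ZMod p => (a : ZMod p) * s ^ (k : ℕ)) := by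
  obtain ⟨k, hk⟩ := k
  simp only [powerExponents, Finset.mem_filter, Finset.mem_Ico] at hk
  obtain ⟨⟨hk2, -⟩, hc⟩ := hk
  have hk0 : k ≠ 0 := by omega
  have hcard : (Nat.card (ZMod p)ˣ).Coprime k := by
    rw [Nat.card_eq_fintype_card, ZMod.card_units]
    exact hc.symm
  refine Finite.injective_iff_bijective.mp ?_
  intro s t hst
  have h : s ^ k = t ^ k := a.isUnit.mul_left_cancel hst
  by_cases hs : s = 0
  · subst hs
    rw [zero_pow hk0] at h
    exact (pow_eq_zero_iff hk0).mp h.symm |>.symm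
  · have ht : t ≠ 0 := by
      rintro rfl
      rw [zero_pow hk0] at h
      exact hs ((pow_eq_zero_iff hk0).mp h)
    have hu : Units.mk0 s hs ^ k = Units.mk0 t ht ^ k := by
      ext
      simpa using h
    have := (powCoprime hcard).injective (a₁ := Units.mk0 s hs) (a₂ := Units.mk0 t ht) hu
    simpa using congrArg Units.val this

/-- The power permutation `η_{a,k}(s) = a s^k` of `ℤ/pℤ`. -/
noncomputable def powerPerm (p : ℕ) [Fact p.Prime] (a : (ZMod p)ˣ) (k : powerExponents p) :
    Equiv.Perm (ZMod p) :=
  Equiv.ofBijective (fun s : ZMod p => (a : ZMod p) * s ^ (k : ℕ)) (powerMap_bijective p a k)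

/-! Expanding both intervals in additive characters bounds the discrepancy of s ↦ a s^k by a sum
over nonzero u, v of 1/(|u||v|) times the norm of Σ_s ψ(u a s^k + v s). The substitution s ↦ v⁻¹ s
reduces these sums to a family with one parameter t = u a v^(-k), and Hölder's inequality with
exponents 4 and 4/3 leaves its fourth moment over t. That moment is at most p² T_k, where T_k is the
number of solutions of x + y = z + 1, x^k + y^k = z^k + 1 in units. Hence D ≪ (p + p² T_k)^(1/4),
uniformly in a (`exists_permDiscrepancy_le`).

It remains to bound T_k on average over k (`exists_sum_card_coincidences_le`). A nontrivial triple
(x, y, z) of order m satisfies the second equation for only O(p m^(-1/3)) exponents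
(`card_coincidence_le`): some power of the triple, not 1, has small discrete logarithms, so along
progressions of exponents the equation becomes a polynomial equation of low degree. At most m²
triples of order m satisfy the first equation, so Σ_k T_k ≪ p² + p Σ_{m ∣ p-1} m^(5/3) ≪ p^(8/3).

Let l = log log p. By Markov's inequality, T_k > p^(5/3) l⁴ for only O(p/l⁴) exponents, which is
negligible against the ≫ p/l² admissible ones (`le_card_powerExponents`). For all others the fourth
root is ≪ p^(11/12) l. -/

/-! ### Exponents for which a fixed triple is a coincidence -/

section CoincidenceCount

open Finset Polynomial

/-- A four-term polynomial relation can only be trivial if its exponents cancel in pairs or are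
all equal. -/
theorem four_term_eq_zero {F : Type*} [Field F] {a b c d : F} (ha : a ≠ 0) (hb : b ≠ 0)
    (hc : c ≠ 0) (hd : d ≠ 0) {r₁ r₂ r₃ r₄ : ℕ}
    (h : C a * X ^ r₁ + C b * X ^ r₂ - C c * X ^ r₃ - C d * X ^ r₄ = 0) :
    (r₁ = r₄ ∧ r₂ = r₄ ∧ r₃ = r₄) ∨ (r₁ = r₄ ∧ r₂ = r₃ ∧ a = d ∧ b = c) ∨
      (r₂ = r₄ ∧ r₁ = r₃ ∧ b = d ∧ a = c) ∨ (r₁ = r₂ ∧ r₃ = r₄ ∧ a = -b ∧ c = -d) := by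
  have key : ∀ i : ℕ, (if i = r₁ then a else 0) + (if i = r₂ then b else 0)
      - (if i = r₃ then c else 0) - (if i = r₄ then d else 0) = 0 := by
    intro i
    have := congrArg (fun P => coeff P i) h
    simpa [coeff_X_pow] using this
  by_cases h14 : r₁ = r₄ <;> by_cases h24 : r₂ = r₄
  · refine Or.inl ⟨h14, h24, ?_⟩
    by_contra h34
    have h3 := key r₃
    simp [h14, h24, h34, hc] at h3
  · have h2 := key r₂
    have h23 : r₂ = r₃ := by
      by_contra h23
      simp [h14, h24, h23, hb] at h2
    have h1 := key r₁
    simp only [← h14] at h24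
    simp [← h23, ← h14, h24, Ne.symm h24, sub_eq_zero] at h1 h2
    exact Or.inr (Or.inl ⟨h14, h23, h1, h2⟩)
  · have h1 := key r₁
    have h13 : r₁ = r₃ := by
      by_contra h13
      simp [h14, h24, h13, ha] at h1
    have h2 := key r₂
    simp only [← h24] at h14
    simp [← h13, ← h24, h14, Ne.symm h14, sub_eq_zero] at h1 h2
    exact Or.inr (Or.inr (Or.inl ⟨h24, h13, h2, h1⟩))
  · have h4 := key r₄
    have h34 : r₃ = r₄ := by
      by_contra h34
      simp [Ne.symm h14, Ne.symm h24, Ne.symm h34, hd] at h4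
    have h1 := key r₁
    have h12 : r₁ = r₂ := by
      by_contra h12
      simp [h14, h12, h34, ha] at h1
    simp [h34, ← h12, h14, Ne.symm h14] at h1 h4
    exact Or.inr (Or.inr (Or.inr ⟨h12, h34, by linear_combination h1, by linear_combination -h4⟩))

/-- `B` is the least natural number with m ≤ (B + 1)³; the condition 2 ≤ m excludes B = 0. -/
theorem exists_cube_lt {m : ℕ} (hm : 2 ≤ m) : ∃ B : ℕ, 1 ≤ B ∧ B ^ 3 < m ∧ m ≤ (B + 1) ^ 3 := by
  have hex : ∃ B : ℕ, m ≤ (B + 1) ^ 3 :=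
    ⟨m, (Nat.le_succ m).trans (Nat.le_self_pow (by norm_num) _)⟩
  classical
  have hB := Nat.find_spec hex
  refine ⟨Nat.find hex, ?_, ?_, hB⟩
  · by_contra h0
    have : Nat.find hex = 0 := by omega
    rw [this] at hB
    omega
  · rcases Nat.eq_zero_or_pos (Nat.find hex) with h0 | h0
    · rw [h0]; omega
    · have := Nat.find_min hex (m := Nat.find hex - 1) (by omega)
      rw [Nat.sub_add_cancel h0] at this
      omega

/-- Simultaneous approximation in a finite cyclic group: some power of the triple `(x, y, z)`,
not trivial, consists of small powers of the generator. -/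
theorem exists_small_exponents {G : Type*} [CommGroup G] [Finite G] {g : G}
    (hg : ∀ x, x ∈ Subgroup.zpowers g) (x y z : G) {B : ℕ} (hB : 1 ≤ B)
    (hm : B ^ 3 < orderOf (x, y, z)) :
    ∃ u r₁ r₂ r₃ : ℕ, (x, y, z) ^ u ≠ 1 ∧ r₁ ≤ 2 * (Nat.card G / B) ∧ r₂ ≤ 2 * (Nat.card G / B) ∧
      r₃ ≤ 2 * (Nat.card G / B) ∧ g ^ r₁ = g ^ (Nat.card G / B) * x ^ u ∧
      g ^ r₂ = g ^ (Nat.card G / B) * y ^ u ∧ g ^ r₃ = g ^ (Nat.card G / B) * z ^ u := by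
  have hcard : orderOf g = Nat.card G := orderOf_eq_card_of_forall_mem_zpowers hg
  have hpos : 0 < Nat.card G := Nat.card_pos
  have hlog : ∀ x : G, ∃ v : ℕ, v < Nat.card G ∧ g ^ v = x := by
    intro x
    classical
    obtain ⟨v, hv, h⟩ := Finset.mem_image.mp
      ((isOfFinOrder_of_finite g).mem_zpowers_iff_mem_range_orderOf.mp (hg x))
    exact ⟨v, hcard ▸ Finset.mem_range.mp hv, h⟩
  choose dl hdl hgdl using hlog
  set N := Nat.card G with hN
  have hbox : ∀ x : G, dl x * B / N < B := fun x => by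
    rw [Nat.div_lt_iff_lt_mul hpos, mul_comm B]
    exact Nat.mul_lt_mul_of_pos_right (hdl x) (by omega)
  -- Dirichlet's pigeonhole: the powers of the triple outnumber the B³ boxes of discrete logarithms,
  -- so two of them share a box.
  obtain ⟨s, hs, t, ht, hst, heq⟩ := Finset.exists_ne_map_eq_of_card_lt_of_maps_to
    (s := range (orderOf (x, y, z))) (t := range B ×ˢ range B ×ˢ range B)
    (by simpa [pow_succ, mul_assoc] using hm)
    (f := fun u => (dl (x ^ u) * B / N, dl (y ^ u) * B / N, dl (z ^ u) * B / N))
    (by intro u _; simp [hbox])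
  wlog hlt : s < t generalizing s t
  · exact this t ht s hs hst.symm heq.symm (by omega)
  simp only [Prod.mk.injEq] at heq
  obtain ⟨h1, h2, h3⟩ := heq
  have small : ∀ w : G, dl (w ^ s) * B / N = dl (w ^ t) * B / N →
      ∃ r : ℕ, r ≤ 2 * (N / B) ∧ g ^ r = g ^ (N / B) * w ^ (t - s) := by
    intro w hw
    have e1 := Nat.div_add_mod (dl (w ^ s) * B) N
    have e2 := Nat.div_add_mod (dl (w ^ t) * B) N
    have l1 := Nat.mod_lt (dl (w ^ s) * B) hpos
    have l2 := Nat.mod_lt (dl (w ^ t) * B) hpos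
    rw [hw] at e1
    generalize N * (dl (w ^ t) * B / N) = q at e1 e2
    have hle1 : dl (w ^ s) ≤ dl (w ^ t) + N / B := by
      rcases le_total (dl (w ^ s)) (dl (w ^ t)) with h | h
      · exact h.trans (Nat.le_add_right _ _)
      · have : (dl (w ^ s) - dl (w ^ t)) ≤ N / B := by
          rw [Nat.le_div_iff_mul_le (by omega), Nat.sub_mul]; omega
        omega
    have hle2 : dl (w ^ t) ≤ dl (w ^ s) + N / B := by
      rcases le_total (dl (w ^ t)) (dl (w ^ s)) with h | h
      · exact h.trans (Nat.le_add_right _ _)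
      · have : (dl (w ^ t) - dl (w ^ s)) ≤ N / B := by
          rw [Nat.le_div_iff_mul_le (by omega), Nat.sub_mul]; omega
        omega
    -- Logarithms in one box differ by at most N / B in either direction; the shift by N / B keeps
    -- the exponent a natural number.
    refine ⟨N / B + dl (w ^ t) - dl (w ^ s), by omega, ?_⟩
    have hcancel : g ^ (N / B + dl (w ^ t) - dl (w ^ s)) * g ^ dl (w ^ s)
        = (g ^ (N / B) * w ^ (t - s)) * g ^ dl (w ^ s) := by
      rw [← pow_add, Nat.sub_add_cancel (by omega), pow_add, hgdl, hgdl, mul_assoc, ← pow_add,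
        Nat.sub_add_cancel hlt.le]
    exact mul_right_cancel hcancel
  obtain ⟨r₁, hr1, e1⟩ := small x h1
  obtain ⟨r₂, hr2, e2⟩ := small y h2
  obtain ⟨r₃, hr3, e3⟩ := small z h3
  refine ⟨t - s, r₁, r₂, r₃, ?_, hr1, hr2, hr3, e1, e2, e3⟩
  intro h
  have := Nat.le_of_dvd (by omega) (orderOf_dvd_of_pow_eq_one h)
  simp only [mem_range] at ht
  omega

/-- Solutions of `x + y = z + 1` whose terms cancel in pairs. -/
def IsTrivialSolution {p : ℕ} (x y z : (ZMod p)ˣ) : Prop :=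
  (x = 1 ∧ y = z) ∨ (y = 1 ∧ x = z) ∨ (x = -y ∧ z = -1)

theorem pow_val_add {G : Type*} [Monoid G] {n : ℕ} [NeZero n] {x : G} (hx : x ^ n = 1)
    (i j : ZMod n) : x ^ (i + j).val = x ^ i.val * x ^ j.val := by
  rw [ZMod.val_add, ← pow_add]
  exact (pow_eq_pow_mod _ hx).symm

theorem pow_val_natCast_mul {G : Type*} [Monoid G] {n : ℕ} [NeZero n] {x : G} (hx : x ^ n = 1)
    (u : ℕ) (j : ZMod n) : x ^ ((u : ZMod n) * j).val = (x ^ u) ^ j.val := by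
  rw [ZMod.val_mul, ZMod.val_natCast, ← pow_mul, ← pow_eq_pow_mod _ hx, pow_mul, pow_mul,
    ← pow_eq_pow_mod u hx]

/-- Each class modulo p - 1 is c + u j for exactly p - 1 pairs (c, j), so it suffices to bound the
solutions j for each fixed c. With X = g^j these are roots of a nonzero four-term polynomial of
degree at most 2L. -/
theorem card_coincidence_le {p : ℕ} [Fact p.Prime] (hp : 3 ≤ p) {x y z : (ZMod p)ˣ}
    (hxyz : ¬ IsTrivialSolution x y z) {B : ℕ} (hB : 1 ≤ B) (hm : B ^ 3 < orderOf (x, y, z)) :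
    #{k ∈ powerExponents p | (x : ZMod p) ^ k + (y : ZMod p) ^ k = (z : ZMod p) ^ k + 1}
      ≤ 2 * ((p - 1) / B) := by
  classical
  have hn : 0 < p - 1 := by omega
  have : NeZero (p - 1) := ⟨hn.ne'⟩
  have hcardU : Nat.card (ZMod p)ˣ = p - 1 := by
    rw [Nat.card_eq_fintype_card, ZMod.card_units]
  obtain ⟨g, hg⟩ := IsCyclic.exists_generator (α := (ZMod p)ˣ)
  have hordg : orderOf g = p - 1 := by rw [orderOf_eq_card_of_forall_mem_zpowers hg, hcardU]
  obtain ⟨u, r₁, r₂, r₃, hu, hr1, hr2, hr3, e1, e2, e3⟩ := exists_small_exponents hg x y z hB hm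
  rw [hcardU] at hr1 hr2 hr3 e1 e2 e3
  set L := (p - 1) / B with hL
  have hone : ∀ w : (ZMod p)ˣ, w ^ (p - 1) = 1 := fun w => by
    rw [← hcardU]; exact pow_card_eq_one'
  set S : Finset (ZMod (p - 1)) := univ.filter (fun k => k.val.Coprime (p - 1) ∧
    (x : ZMod p) ^ k.val + (y : ZMod p) ^ k.val = (z : ZMod p) ^ k.val + 1) with hS
  have hle : #{k ∈ powerExponents p | (x : ZMod p) ^ k + (y : ZMod p) ^ k = (z : ZMod p) ^ k + 1}
      ≤ #S := by
    refine card_le_card_of_injOn (fun k : ℕ => (k : ZMod (p - 1))) ?_ ?_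
    · intro k hk
      simp only [powerExponents, coe_filter, Finset.mem_filter, Finset.mem_Ico,
        Set.mem_ofPred_eq] at hk
      have hv : ((k : ℕ) : ZMod (p - 1)).val = k := ZMod.val_cast_of_lt hk.1.1.2
      simp only [hS, coe_filter, Finset.mem_univ, true_and, Set.mem_ofPred_eq, hv]
      exact ⟨hk.1.2, hk.2⟩
    · intro k hk l hl hkl
      simp only [powerExponents, coe_filter, Finset.mem_filter, Finset.mem_Ico,
        Set.mem_ofPred_eq] at hk hl
      have := congrArg ZMod.val hkl
      simpa [ZMod.val_cast_of_lt hk.1.1.2, ZMod.val_cast_of_lt hl.1.1.2] using this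
  refine hle.trans ?_
  have hfib : ∀ c : ZMod (p - 1), #{j : ZMod (p - 1) | c + u * j ∈ S} ≤ 2 * L := by
    intro c
    rcases Finset.eq_empty_or_nonempty ({j : ZMod (p - 1) | c + u * j ∈ S} : Finset _) with h0 | ⟨j, hj⟩
    · rw [h0]; simp
    -- The equation at the exponent c + u j, multiplied by X^L to clear negative powers of X = g^j.
    set P : (ZMod p)[X] := C ((x ^ c.val : (ZMod p)ˣ) : ZMod p) * X ^ r₁
      + C ((y ^ c.val : (ZMod p)ˣ) : ZMod p) * X ^ r₂
      - C ((z ^ c.val : (ZMod p)ˣ) : ZMod p) * X ^ r₃ - C 1 * X ^ L with hP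
    have hsplit : ∀ (w : (ZMod p)ˣ) (i : ZMod (p - 1)),
        w ^ (c + u * i).val = w ^ c.val * (w ^ u) ^ i.val := fun w i => by
      rw [pow_val_add (hone w), pow_val_natCast_mul (hone w)]
    -- If P vanished, its terms would cancel. The fibre contains an exponent coprime to p - 1, whose
    -- power map is injective on units, so the cancellation would descend to x, y, z and make the
    -- triple trivial.
    have hP0 : P ≠ 0 := by
      intro h
      simp only [Finset.mem_filter, Finset.mem_univ, true_and, hS] at hj
      obtain ⟨hcop, -⟩ := hj
      have hinj : Function.Injective (fun w : (ZMod p)ˣ => w ^ (c + u * j).val) :=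
        (powCoprime (G := (ZMod p)ˣ) (n := (c + u * j).val) (by rw [hcardU]; exact hcop.symm)).injective
      -- Oddness is needed for the family x = -y, z = -1, where signs must pass through the power.
      have hodd : Odd (c + u * j).val := by
        have heven : Even (p - 1) := (Fact.out : p.Prime).even_sub_one (by omega)
        rw [← Nat.not_even_iff_odd]
        intro he
        exact Nat.not_coprime_of_dvd_of_dvd (by norm_num) he.two_dvd heven.two_dvd hcop
      rcases four_term_eq_zero (Units.ne_zero _) (Units.ne_zero _) (Units.ne_zero _)
        one_ne_zero h with ⟨h1, h2, h3⟩ | ⟨h1, h2, h3, h4⟩ | ⟨h1, h2, h3, h4⟩ | ⟨h1, h2, h3, h4⟩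
      · apply hu
        rw [h1, left_eq_mul] at e1
        rw [h2, left_eq_mul] at e2
        rw [h3, left_eq_mul] at e3
        simp [Prod.pow_mk, e1, e2, e3]
      · rw [h1, left_eq_mul] at e1
        rw [h2, e3, mul_right_inj] at e2
        refine hxyz (Or.inl ⟨hinj ?_, hinj ?_⟩)
        · have h3' : x ^ c.val = 1 := Units.ext h3
          simp [hsplit, e1, h3']
        · have h4' : y ^ c.val = z ^ c.val := by exact_mod_cast h4
          simp [hsplit, e2, h4']
      · rw [h1, left_eq_mul] at e2
        rw [h2, e3, mul_right_inj] at e1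
        refine hxyz (Or.inr (Or.inl ⟨hinj ?_, hinj ?_⟩))
        · have h3' : y ^ c.val = 1 := Units.ext h3
          simp [hsplit, e2, h3']
        · have h4' : x ^ c.val = z ^ c.val := by exact_mod_cast h4
          simp [hsplit, e1, h4']
      · rw [h1, e2, mul_right_inj] at e1
        rw [h2, left_eq_mul] at e3
        refine hxyz (Or.inr (Or.inr ⟨hinj ?_, hinj ?_⟩))
        · have h3' : x ^ c.val = -y ^ c.val := by ext; simpa using h3
          simp only [hodd.neg_pow, hsplit, e1, h3', neg_mul]
        · have h4' : z ^ c.val = -1 := by ext; simpa using h4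
          simp only [hodd.neg_pow, hsplit, e3, h4', one_pow, mul_one]
    have hdeg : P.natDegree ≤ 2 * L := by
      rw [hP]
      have hX : ∀ (a : ZMod p) {r : ℕ}, r ≤ 2 * L → (C a * X ^ r).natDegree ≤ 2 * L :=
        fun a r hr => (natDegree_C_mul_X_pow_le _ _).trans hr
      exact (natDegree_sub_le_iff_left (hX _ (by omega))).mpr <|
        (natDegree_sub_le_iff_left (hX _ hr3)).mpr <| natDegree_add_le_of_degree_le (hX _ hr1) (hX _ hr2)
    refine le_trans ?_ ((card_roots' P).trans hdeg)
    refine le_trans ?_ (Multiset.toFinset_card_le P.roots)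
    refine card_le_card_of_injOn (fun i : ZMod (p - 1) => ((g ^ i.val : (ZMod p)ˣ) : ZMod p)) ?_ ?_
    · intro i hi
      simp only [hS, coe_filter, Finset.mem_univ, true_and, Set.mem_ofPred_eq,
        Finset.mem_filter] at hi
      obtain ⟨-, hi⟩ := hi
      simp only [Finset.mem_coe, Multiset.mem_toFinset, mem_roots hP0, IsRoot.def]
      have hpow : ∀ {r : ℕ} {w : (ZMod p)ˣ}, g ^ r = g ^ L * w ^ u →
          (g ^ i.val) ^ r = (g ^ i.val) ^ L * (w ^ u) ^ i.val := fun {r w} h => by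
        rw [← pow_mul, mul_comm i.val, pow_mul, h, mul_pow, ← pow_mul, ← pow_mul g i.val,
          mul_comm L]
      have hx : (x : ZMod p) ^ (c + u * i).val = ((x ^ c.val * (x ^ u) ^ i.val : (ZMod p)ˣ) : ZMod p) := by
        rw [← hsplit]; simp
      have hy : (y : ZMod p) ^ (c + u * i).val = ((y ^ c.val * (y ^ u) ^ i.val : (ZMod p)ˣ) : ZMod p) := by
        rw [← hsplit]; simp
      have hz : (z : ZMod p) ^ (c + u * i).val = ((z ^ c.val * (z ^ u) ^ i.val : (ZMod p)ˣ) : ZMod p) := by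
        rw [← hsplit]; simp
      rw [hx, hy, hz] at hi
      simp only [hP, eval_sub, eval_add, eval_mul, eval_C, eval_pow, eval_X]
      rw [← Units.val_pow_eq_pow_val (g ^ i.val), ← Units.val_pow_eq_pow_val (g ^ i.val),
        ← Units.val_pow_eq_pow_val (g ^ i.val), ← Units.val_pow_eq_pow_val (g ^ i.val),
        hpow e1, hpow e2, hpow e3]
      push_cast at hi ⊢
      linear_combination (((g : ZMod p) ^ i.val) ^ L) * hi
    · intro i _ j _ hij
      have h1 : g ^ i.val = g ^ j.val := Units.ext hij
      rw [pow_inj_mod, hordg, Nat.mod_eq_of_lt (ZMod.val_lt i), Nat.mod_eq_of_lt (ZMod.val_lt j)] at h1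
      exact ZMod.val_injective _ h1
  have hsum : ∑ c : ZMod (p - 1), #{j : ZMod (p - 1) | c + u * j ∈ S} = (p - 1) * #S := by
    simp only [card_filter]
    rw [sum_comm]
    have : ∀ j : ZMod (p - 1), ∑ c : ZMod (p - 1), (if c + u * j ∈ S then 1 else 0) = #S := by
      intro j
      refine (Equiv.sum_comp (Equiv.addRight ((u : ZMod (p - 1)) * j))
        (fun c => if c ∈ S then 1 else 0)).trans ?_
      simp
    simp [this, ZMod.card]
  have hsum2 : ∑ c : ZMod (p - 1), #{j : ZMod (p - 1) | c + u * j ∈ S} ≤ (p - 1) * (2 * L) := by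
    refine (Finset.sum_le_sum (fun c _ => hfib c)).trans ?_
    simp [ZMod.card]
  rw [hsum] at hsum2
  exact Nat.le_of_mul_le_mul_left hsum2 hn

end CoincidenceCount

/-! ### The number of coincidences on average over the exponent -/

section AverageCoincidences

open Finset

/-- The solutions `(x, y, z)` in nonzero classes of `x + y = z + 1`, `x ^ k + y ^ k = z ^ k + 1`. -/
noncomputable def coincidences (p : ℕ) [Fact p.Prime] (k : ℕ) :
    Finset ((ZMod p)ˣ × (ZMod p)ˣ × (ZMod p)ˣ) :=
  {t | (t.1 : ZMod p) + t.2.1 = t.2.2 + 1 ∧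
    (t.1 : ZMod p) ^ k + (t.2.1 : ZMod p) ^ k = (t.2.2 : ZMod p) ^ k + 1}

theorem card_coincidence_le_rpow {p : ℕ} [Fact p.Prime] (hp : 3 ≤ p) {x y z : (ZMod p)ˣ}
    (hxyz : ¬ IsTrivialSolution x y z) :
    (#{k ∈ powerExponents p | (x : ZMod p) ^ k + (y : ZMod p) ^ k = (z : ZMod p) ^ k + 1} : ℝ)
      ≤ 4 * p * (orderOf (x, y, z) : ℝ) ^ (-(1 / 3) : ℝ) := by
  have h2 : 2 ≤ orderOf (x, y, z) := by
    by_contra h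
    have h0 : 0 < orderOf (x, y, z) := orderOf_pos _
    have h1 : orderOf (x, y, z) = 1 := by omega
    rw [orderOf_eq_one_iff] at h1
    simp only [Prod.mk_eq_one] at h1
    exact hxyz (Or.inl ⟨h1.1, h1.2.1.trans h1.2.2.symm⟩)
  obtain ⟨B, hB1, hBm, hmB⟩ := exists_cube_lt h2
  have hc := card_coincidence_le hp hxyz hB1 hBm
  set N := #{k ∈ powerExponents p | (x : ZMod p) ^ k + (y : ZMod p) ^ k = (z : ZMod p) ^ k + 1}
  set m := orderOf (x, y, z)
  have hNB : N * (B + 1) ≤ 4 * p := by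
    have h1 : N * B ≤ 2 * ((p - 1) / B * B) := by
      rw [← mul_assoc]; exact Nat.mul_le_mul_right _ hc
    have h2 := Nat.div_mul_le_self (p - 1) B
    -- Since B ≥ 1, passing from B to B + 1 ≥ m^(1/3) costs a factor 2; this is how 2 becomes 4.
    have h3 : N * (B + 1) ≤ N * (2 * B) := Nat.mul_le_mul_left _ (by omega)
    have h4 : N * (2 * B) = 2 * (N * B) := by ring
    omega
  have hm0 : (0 : ℝ) < m := by exact_mod_cast (by omega : 0 < m)
  have hroot : (m : ℝ) ^ (1 / 3 : ℝ) ≤ B + 1 := by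
    have h : (m : ℝ) ≤ ((B : ℝ) + 1) ^ (3 : ℝ) := by
      rw [show (3 : ℝ) = (3 : ℕ) by norm_num, Real.rpow_natCast]; exact_mod_cast hmB
    calc (m : ℝ) ^ (1 / 3 : ℝ) ≤ (((B : ℝ) + 1) ^ (3 : ℝ)) ^ (1 / 3 : ℝ) := by gcongr
      _ = B + 1 := by rw [← Real.rpow_mul (by positivity)]; norm_num
  rw [Real.rpow_neg hm0.le, ← div_eq_mul_inv, le_div_iff₀ (by positivity)]
  calc (N : ℝ) * (m : ℝ) ^ (1 / 3 : ℝ) ≤ N * (B + 1) := by gcongr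
    _ ≤ 4 * p := by exact_mod_cast hNB

theorem card_isTrivialSolution_le (p : ℕ) [Fact p.Prime]
    [DecidablePred fun t : (ZMod p)ˣ × (ZMod p)ˣ × (ZMod p)ˣ => IsTrivialSolution t.1 t.2.1 t.2.2] :
    #{t : (ZMod p)ˣ × (ZMod p)ˣ × (ZMod p)ˣ | IsTrivialSolution t.1 t.2.1 t.2.2} ≤ 3 * p := by
  classical
  have hU : #(univ : Finset (ZMod p)ˣ) ≤ p := by
    rw [card_univ, ZMod.card_units]; omega
  have hsub : ({t | IsTrivialSolution t.1 t.2.1 t.2.2} : Finset ((ZMod p)ˣ × (ZMod p)ˣ × (ZMod p)ˣ))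
      ⊆ (univ.image fun y => (1, y, y)) ∪ (univ.image fun x => (x, 1, x)) ∪
        (univ.image fun y => (-y, y, -1)) := by
    rintro ⟨x, y, z⟩ h
    replace h : IsTrivialSolution x y z := (mem_filter.mp h).2
    unfold IsTrivialSolution at h
    simp only [mem_union, mem_image, mem_univ, true_and, Prod.mk.injEq]
    rcases h with ⟨rfl, rfl⟩ | ⟨rfl, rfl⟩ | ⟨rfl, rfl⟩
    · exact Or.inl (Or.inl ⟨y, rfl, rfl, rfl⟩)
    · exact Or.inl (Or.inr ⟨x, rfl, rfl, rfl⟩)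
    · exact Or.inr ⟨y, rfl, rfl, rfl⟩
  refine (card_le_card hsub).trans ((card_union_le _ _).trans ?_)
  have := card_union_le (univ.image fun y : (ZMod p)ˣ => ((1 : (ZMod p)ˣ), y, y))
    (univ.image fun x : (ZMod p)ˣ => (x, (1 : (ZMod p)ˣ), x))
  have h1 := (card_image_le (s := univ) (f := fun y : (ZMod p)ˣ => ((1 : (ZMod p)ˣ), y, y))).trans hU
  have h2 := (card_image_le (s := univ) (f := fun x : (ZMod p)ˣ => (x, (1 : (ZMod p)ˣ), x))).trans hU
  have h3 := (card_image_le (s := univ)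
    (f := fun y : (ZMod p)ˣ => (-y, y, (-1 : (ZMod p)ˣ)))).trans hU
  omega

/-- Both x and y are among the at most m roots of w^m = 1, and the linear equation determines z. -/
theorem card_orderOf_eq_le (p : ℕ) [Fact p.Prime] {m : ℕ} (hm : 0 < m) :
    #{t : (ZMod p)ˣ × (ZMod p)ˣ × (ZMod p)ˣ | (t.1 : ZMod p) + t.2.1 = t.2.2 + 1 ∧ orderOf t = m}
      ≤ m ^ 2 := by
  classical
  have hroots := IsCyclic.card_pow_eq_one_le (α := (ZMod p)ˣ) hm
  set R : Finset (ZMod p)ˣ := {a | a ^ m = 1}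
  calc _ ≤ #(R ×ˢ R) := by
        refine card_le_card_of_injOn (fun t => (t.1, t.2.1)) ?_ ?_
        · rintro ⟨x, y, z⟩ h
          simp only [coe_filter, mem_univ, true_and, Set.mem_ofPred_eq] at h
          have h1 : (x, y, z) ^ m = 1 := h.2 ▸ pow_orderOf_eq_one _
          simp only [Prod.pow_mk, Prod.mk_eq_one] at h1
          simp [R, h1.1, h1.2.1]
        · rintro ⟨x, y, z⟩ h ⟨x', y', z'⟩ h' heq
          simp only [coe_filter, mem_univ, true_and, Set.mem_ofPred_eq, Prod.mk.injEq] at h h' heq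
          obtain ⟨rfl, rfl⟩ := heq
          have : z = z' := Units.ext (add_right_cancel (h.1.symm.trans h'.1))
          rw [this]
    _ ≤ m ^ 2 := by rw [card_product, sq]; exact Nat.mul_le_mul hroots hroots

/-- Passing to complementary divisors leaves a convergent series, so no divisor-function factor is
lost. -/
theorem sum_divisors_rpow_le {s : ℝ} (hs : 1 < s) {n : ℕ} :
    ∑ m ∈ n.divisors, (m : ℝ) ^ s ≤ (∑' e : ℕ, (e : ℝ) ^ (-s)) * (n : ℝ) ^ s := by
  rw [← Nat.sum_div_divisors n (fun m => (m : ℝ) ^ s)]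
  have hsum : Summable fun e : ℕ => (e : ℝ) ^ (-s) := Real.summable_nat_rpow.mpr (by linarith)
  calc ∑ e ∈ n.divisors, ((n / e : ℕ) : ℝ) ^ s
      = ∑ e ∈ n.divisors, (e : ℝ) ^ (-s) * (n : ℝ) ^ s := by
        refine sum_congr rfl fun e he => ?_
        rw [Nat.cast_div_charZero (Nat.dvd_of_mem_divisors he),
          Real.div_rpow (by positivity) (by positivity), Real.rpow_neg (by positivity)]
        ring
    _ = (∑ e ∈ n.divisors, (e : ℝ) ^ (-s)) * (n : ℝ) ^ s := by rw [sum_mul]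
    _ ≤ _ := by
        gcongr
        exact hsum.sum_le_tsum _ fun e _ => by positivity

/-- After interchanging the sums over k and over triples, the O(p) trivial triples contribute O(p²).
The others are grouped by order m, each group contributing at most m² · 4p m^(-1/3). -/
theorem exists_sum_card_coincidences_le : ∃ C : ℝ, 0 < C ∧ ∀ (p : ℕ) [Fact p.Prime], 3 ≤ p →
    ∑ k ∈ powerExponents p, (#(coincidences p k) : ℝ) ≤ C * (p : ℝ) ^ (8 / 3 : ℝ) := by
  classical
  set S : ℝ := ∑' e : ℕ, (e : ℝ) ^ (-(5 / 3) : ℝ)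
  have hS : 0 ≤ S := tsum_nonneg fun e => by positivity
  refine ⟨3 + 4 * S, by positivity, fun p _ hp => ?_⟩
  have hp0 : (0 : ℝ) < p := by exact_mod_cast (by omega : 0 < p)
  have hp1 : (1 : ℝ) ≤ p := by exact_mod_cast (by omega : 1 ≤ p)
  set E : Finset ((ZMod p)ˣ × (ZMod p)ˣ × (ZMod p)ˣ) := {t | (t.1 : ZMod p) + t.2.1 = t.2.2 + 1}
    with hE
  set q : (ZMod p)ˣ × (ZMod p)ˣ × (ZMod p)ˣ → ℕ := fun t => #{k ∈ powerExponents p |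
    (t.1 : ZMod p) ^ k + (t.2.1 : ZMod p) ^ k = (t.2.2 : ZMod p) ^ k + 1} with hq
  have hK : #(powerExponents p) ≤ p := by
    refine (card_filter_le _ _).trans ?_
    rw [Nat.card_Ico]; omega
  have hswap : ∑ k ∈ powerExponents p, (#(coincidences p k) : ℝ) = ∑ t ∈ E, (q t : ℝ) := by
    have h : ∑ k ∈ powerExponents p, #(coincidences p k) = ∑ t ∈ E, q t := by
      refine Eq.trans (sum_congr rfl fun k _ => ?_)
        (sum_card_bipartiteAbove_eq_sum_card_bipartiteBelow
          (fun (k : ℕ) (t : (ZMod p)ˣ × (ZMod p)ˣ × (ZMod p)ˣ) =>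
            (t.1 : ZMod p) ^ k + (t.2.1 : ZMod p) ^ k = (t.2.2 : ZMod p) ^ k + 1))
      simp only [coincidences, bipartiteAbove, hE, filter_filter]
    exact_mod_cast h
  have hbound : ∀ t ∈ E, (q t : ℝ) ≤ (if IsTrivialSolution t.1 t.2.1 t.2.2 then (p : ℝ) else 0) +
      4 * p * (orderOf t : ℝ) ^ (-(1 / 3) : ℝ) := by
    rintro ⟨x, y, z⟩ -
    split_ifs with h
    · have h1 : (q (x, y, z) : ℝ) ≤ p := by exact_mod_cast (card_filter_le _ _).trans hK
      have h2 : 0 ≤ 4 * p * (orderOf (x, y, z) : ℝ) ^ (-(1 / 3) : ℝ) := by positivity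
      linarith
    · rw [zero_add]; exact card_coincidence_le_rpow hp h
  have htriv : ∑ t ∈ E, (if IsTrivialSolution t.1 t.2.1 t.2.2 then (p : ℝ) else 0)
      ≤ 3 * (p : ℝ) ^ (8 / 3 : ℝ) := by
    calc _ ≤ ∑ t : (ZMod p)ˣ × (ZMod p)ˣ × (ZMod p)ˣ,
          (if IsTrivialSolution t.1 t.2.1 t.2.2 then (p : ℝ) else 0) :=
          sum_le_sum_of_subset_of_nonneg (subset_univ _) fun t _ _ => by positivity
      _ = #{t : (ZMod p)ˣ × (ZMod p)ˣ × (ZMod p)ˣ | IsTrivialSolution t.1 t.2.1 t.2.2} * (p : ℝ) := by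
          rw [← sum_filter, sum_const, nsmul_eq_mul]
      _ ≤ (3 * p : ℕ) * (p : ℝ) := by gcongr; exact card_isTrivialSolution_le p
      _ = 3 * (p : ℝ) ^ (2 : ℝ) := by rw [Real.rpow_two]; push_cast; ring
      _ ≤ 3 * (p : ℝ) ^ (8 / 3 : ℝ) := by
          gcongr 3 * ?_
          exact Real.rpow_le_rpow_of_exponent_le hp1 (by norm_num)
  have hmain : ∑ t ∈ E, (orderOf t : ℝ) ^ (-(1 / 3) : ℝ) ≤ S * (p : ℝ) ^ (5 / 3 : ℝ) := by
    have hmaps : ∀ t ∈ E, orderOf t ∈ (p - 1).divisors := fun t _ => by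
      rw [Nat.mem_divisors]
      refine ⟨orderOf_dvd_of_pow_eq_one ?_, by omega⟩
      have h1 : ∀ w : (ZMod p)ˣ, w ^ (p - 1) = 1 := fun w => ZMod.units_pow_card_sub_one_eq_one p w
      obtain ⟨x, y, z⟩ := t
      simp [h1]
    rw [← sum_fiberwise_of_maps_to hmaps]
    calc _ ≤ ∑ m ∈ (p - 1).divisors, (m : ℝ) ^ (5 / 3 : ℝ) := by
          refine sum_le_sum fun m hm => ?_
          have hm0 : 0 < m := Nat.pos_of_mem_divisors hm
          have hm0' : (0 : ℝ) < m := by exact_mod_cast hm0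
          calc _ = ∑ t ∈ E with orderOf t = m, (m : ℝ) ^ (-(1 / 3) : ℝ) :=
                sum_congr rfl fun t ht => by rw [(mem_filter.mp ht).2]
            _ = #{t ∈ E | orderOf t = m} * (m : ℝ) ^ (-(1 / 3) : ℝ) := by
                rw [sum_const, nsmul_eq_mul]
            _ ≤ (m ^ 2 : ℕ) * (m : ℝ) ^ (-(1 / 3) : ℝ) := by
                gcongr
                rw [hE, filter_filter]
                exact card_orderOf_eq_le p hm0
            _ = (m : ℝ) ^ (5 / 3 : ℝ) := by
                rw [Nat.cast_pow, ← Real.rpow_natCast, ← Real.rpow_add hm0']; norm_num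
      _ ≤ S * ((p - 1 : ℕ) : ℝ) ^ (5 / 3 : ℝ) := sum_divisors_rpow_le (by norm_num)
      _ ≤ S * (p : ℝ) ^ (5 / 3 : ℝ) := by gcongr; omega
  rw [hswap]
  calc _ ≤ ∑ t ∈ E, ((if IsTrivialSolution t.1 t.2.1 t.2.2 then (p : ℝ) else 0) +
        4 * p * (orderOf t : ℝ) ^ (-(1 / 3) : ℝ)) := sum_le_sum hbound
    _ ≤ 3 * (p : ℝ) ^ (8 / 3 : ℝ) + 4 * p * (S * (p : ℝ) ^ (5 / 3 : ℝ)) := by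
        rw [sum_add_distrib, ← mul_sum]
        gcongr
    _ = _ := by
        rw [show (8 / 3 : ℝ) = 1 + 5 / 3 by norm_num, Real.rpow_add hp0, Real.rpow_one]; ring

end AverageCoincidences

/-! ### A lower bound for Euler's function by Chebyshev's method -/

section TotientLowerBound

open Finset

/-- Chebyshev's argument: with n = 2^j, the primes in (n, 2n] all divide the central binomial
coefficient, which is at most 4^n. -/
theorem mul_card_primes_Ioc_two_pow_le (j : ℕ) :
    j * #{q ∈ Ioc (2 ^ j) (2 ^ (j + 1)) | q.Prime} ≤ 2 * 2 ^ j := by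
  set A : Finset ℕ := {q ∈ Ioc (2 ^ j) (2 ^ (j + 1)) | q.Prime} with hA
  have hmem : ∀ q ∈ A, 2 ^ j < q ∧ q ≤ 2 * 2 ^ j ∧ q.Prime := fun q hq => by
    simp only [hA, mem_filter, mem_Ioc, pow_succ'] at hq
    exact ⟨hq.1.1, hq.1.2, hq.2⟩
  have h1 : (2 ^ j) ^ #A ≤ ∏ q ∈ A, q := by
    rw [← prod_const]
    exact prod_le_prod' fun q hq => (hmem q hq).1.le
  have h2 : ∏ q ∈ A, q ∣ (2 ^ j).centralBinom := by
    refine prod_primes_dvd _ (fun q hq => (hmem q hq).2.2.prime) fun q hq => ?_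
    obtain ⟨hl, hu, hq⟩ := hmem q hq
    rw [Nat.centralBinom_eq_two_mul_choose]
    exact hq.dvd_choose hl (by omega) hu
  have h3 : (2 ^ j) ^ #A ≤ 4 ^ (2 ^ j) :=
    h1.trans ((Nat.le_of_dvd (Nat.centralBinom_pos _) h2).trans (Nat.centralBinom_le_four_pow _))
  rw [show (4 : ℕ) = 2 ^ 2 by norm_num, ← pow_mul, ← pow_mul] at h3
  exact (Nat.pow_le_pow_iff_right (by norm_num)).mp h3

theorem sum_inv_pred_le {A : Finset ℕ} {M : ℕ} (hM : 0 < M) (hA : ∀ q ∈ A, M < q) :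
    ∑ q ∈ A, ((q : ℝ) - 1)⁻¹ ≤ #A / M := by
  rw [div_eq_mul_inv, ← nsmul_eq_mul, ← sum_const]
  refine sum_le_sum fun q hq => ?_
  have h1 : (M : ℝ) + 1 ≤ q := by exact_mod_cast hA q hq
  have h0 : (0 : ℝ) < M := by exact_mod_cast hM
  gcongr
  linarith

/-- A weak Mertens estimate: the dyadic block (2^j, 2^(j+1)] contributes at most 2/j. The factor 2
in front of the harmonic sum is the source of the square in `le_exp_mul_totient`. -/
theorem sum_primes_inv_pred_le (J : ℕ) :
    ∑ q ∈ (Icc 1 (2 ^ (J + 1)) : Finset ℕ) with q.Prime, ((q : ℝ) - 1)⁻¹ ≤ 1 + 2 * (harmonic J : ℝ) := by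
  induction J with
  | zero =>
    have : ({q ∈ Icc 1 (2 ^ (0 + 1)) | q.Prime} : Finset ℕ) = {2} := by decide
    rw [this]
    norm_num
  | succ J ih =>
    have hsplit : ({q ∈ Icc 1 (2 ^ (J + 1 + 1)) | q.Prime} : Finset ℕ) =
        {q ∈ Icc 1 (2 ^ (J + 1)) | q.Prime} ∪ {q ∈ Ioc (2 ^ (J + 1)) (2 ^ (J + 1 + 1)) | q.Prime} := by
      rw [← filter_union]
      congr 1
      ext q
      have : 2 ^ (J + 1) ≤ 2 ^ (J + 1 + 1) := Nat.pow_le_pow_right (by norm_num) (by omega)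
      have : 1 ≤ 2 ^ (J + 1) := Nat.one_le_two_pow
      simp only [mem_union, mem_Icc, mem_Ioc]
      omega
    have hdisj : Disjoint ({q ∈ Icc 1 (2 ^ (J + 1)) | q.Prime} : Finset ℕ)
        {q ∈ Ioc (2 ^ (J + 1)) (2 ^ (J + 1 + 1)) | q.Prime} := by
      rw [disjoint_left]
      intro q h1 h2
      simp only [mem_filter, mem_Icc, mem_Ioc] at h1 h2
      omega
    rw [hsplit, sum_union hdisj, harmonic_succ]
    have hb := mul_card_primes_Ioc_two_pow_le (J + 1)
    have hs := sum_inv_pred_le (A := {q ∈ Ioc (2 ^ (J + 1)) (2 ^ (J + 1 + 1)) | q.Prime})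
      (M := 2 ^ (J + 1)) (by positivity) (fun q hq => (mem_Ioc.mp (mem_filter.mp hq).1).1)
    have hb' : ((J + 1 : ℕ) : ℝ) * #{q ∈ Ioc (2 ^ (J + 1)) (2 ^ (J + 1 + 1)) | q.Prime}
        ≤ 2 * (2 ^ (J + 1) : ℕ) := by exact_mod_cast hb
    have hs' : (#{q ∈ Ioc (2 ^ (J + 1)) (2 ^ (J + 1 + 1)) | q.Prime} : ℝ) / (2 ^ (J + 1) : ℕ)
        ≤ 2 * ((J + 1 : ℕ) : ℝ)⁻¹ := by
      rw [div_le_iff₀ (by positivity), mul_right_comm, ← div_eq_mul_inv, le_div_iff₀ (by positivity)]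
      linarith
    push_cast at ih hs hs' ⊢
    linarith

/-- Prime factors above 2^J number at most 2^J / J, because their product is at most 2^(2^J); each
contributes at most 2^(-J). -/
theorem sum_large_primeFactors_inv_pred_le {n J : ℕ} (hn : 0 < n) (hJ : 1 ≤ J)
    (hnJ : n ≤ 2 ^ 2 ^ J) : ∑ q ∈ n.primeFactors with 2 ^ J < q, ((q : ℝ) - 1)⁻¹ ≤ 1 := by
  refine (sum_inv_pred_le (M := 2 ^ J) (by positivity) fun q hq => (mem_filter.mp hq).2).trans ?_
  set A : Finset ℕ := {q ∈ n.primeFactors | 2 ^ J < q} with hA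
  have h1 : (2 ^ J) ^ #A ≤ ∏ q ∈ A, q := by
    rw [← prod_const]
    exact prod_le_prod' fun q hq => (mem_filter.mp hq).2.le
  have h2 : ∏ q ∈ A, q ∣ n :=
    prod_primes_dvd _ (fun q hq => (Nat.prime_of_mem_primeFactors (mem_filter.mp hq).1).prime)
      fun q hq => Nat.dvd_of_mem_primeFactors (mem_filter.mp hq).1
  have h3 := h1.trans ((Nat.le_of_dvd hn h2).trans hnJ)
  rw [← pow_mul, Nat.pow_le_pow_iff_right (by norm_num)] at h3
  have h4 : #A ≤ 2 ^ J := (Nat.le_mul_of_pos_left _ hJ).trans h3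
  rw [div_le_one (by positivity)]
  exact_mod_cast h4

/-- The lower bound `φ(n) ≫ n / (log log n)²`. -/
theorem le_exp_mul_totient {n J : ℕ} (hn : 0 < n) (hJ : 1 ≤ J) (hnJ : n ≤ 2 ^ 2 ^ J) :
    (n : ℝ) ≤ Real.exp 5 * (J : ℝ) ^ 2 * n.totient := by
  have hsum : ∑ q ∈ n.primeFactors, ((q : ℝ) - 1)⁻¹ ≤ 5 + 2 * Real.log J := by
    rw [← sum_filter_add_sum_filter_not n.primeFactors (fun q => 2 ^ J < q)]
    have h1 := sum_large_primeFactors_inv_pred_le hn hJ hnJ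
    have h2 : ∑ q ∈ n.primeFactors with ¬ 2 ^ J < q, ((q : ℝ) - 1)⁻¹
        ≤ ∑ q ∈ (Icc 1 (2 ^ (J + 1)) : Finset ℕ) with q.Prime, ((q : ℝ) - 1)⁻¹ := by
      refine sum_le_sum_of_subset_of_nonneg ?_ ?_
      · intro q hq
        obtain ⟨hq, hlt⟩ := mem_filter.mp hq
        have hq := Nat.prime_of_mem_primeFactors hq
        have : 2 ^ (J + 1) = 2 * 2 ^ J := pow_succ' _ _
        exact mem_filter.mpr ⟨mem_Icc.mpr ⟨hq.one_lt.le, by omega⟩, hq⟩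
      · intro q hq _
        have : (1 : ℝ) ≤ q := by exact_mod_cast (mem_filter.mp hq).2.one_lt.le
        exact inv_nonneg.mpr (by linarith)
    have h3 := sum_primes_inv_pred_le J
    have h4 := harmonic_le_one_add_log J
    linarith
  -- The Euler product n/φ(n) = ∏ q/(q-1), with q/(q-1) = 1 + 1/(q-1).
  have hprod : (n : ℝ) = n.totient * ∏ q ∈ n.primeFactors, (1 + ((q : ℝ) - 1)⁻¹) := by
    have hq := congrArg (Rat.cast : ℚ → ℝ) (Nat.totient_eq_mul_prod_factors n)
    push_cast at hq
    rw [hq, mul_assoc, ← prod_mul_distrib, prod_eq_one, mul_one]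
    intro q hq
    have hq1 : (1 : ℝ) < q := by exact_mod_cast (Nat.prime_of_mem_primeFactors hq).one_lt
    have : (q : ℝ) - 1 ≠ 0 := by linarith
    have : (q : ℝ) ≠ 0 := by linarith
    field_simp
    ring
  have hJ0 : (0 : ℝ) < J := by exact_mod_cast hJ
  calc (n : ℝ) = n.totient * ∏ q ∈ n.primeFactors, (1 + ((q : ℝ) - 1)⁻¹) := hprod
    _ ≤ n.totient * ∏ q ∈ n.primeFactors, Real.exp (((q : ℝ) - 1)⁻¹) := by
        refine mul_le_mul_of_nonneg_left (prod_le_prod ?_ ?_) (by positivity)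
        · intro q hq
          have hq1 : (1 : ℝ) < q := by exact_mod_cast (Nat.prime_of_mem_primeFactors hq).one_lt
          have : 0 < (q : ℝ) - 1 := by linarith
          positivity
        · intro q _
          rw [add_comm]; exact Real.add_one_le_exp _
    _ = n.totient * Real.exp (∑ q ∈ n.primeFactors, ((q : ℝ) - 1)⁻¹) := by rw [Real.exp_sum]
    _ ≤ n.totient * Real.exp (5 + 2 * Real.log J) := by gcongr
    _ = Real.exp 5 * (J : ℝ) ^ 2 * n.totient := by
        rw [Real.exp_add, two_mul, Real.exp_add, Real.exp_log hJ0]; ring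

/-- Of the classes coprime to p - 1, only k = 1 is excluded from the exponents. -/
theorem totient_le_card_powerExponents_add_one {p : ℕ} (hp : 3 ≤ p) :
    (p - 1).totient ≤ #(powerExponents p) + 1 := by
  rw [Nat.totient_eq_card_coprime]
  have : ({k ∈ range (p - 1) | (p - 1).Coprime k} : Finset ℕ) ⊆ insert 1 (powerExponents p) := by
    intro k hk
    simp only [mem_filter, mem_range] at hk
    simp only [powerExponents, mem_insert, mem_filter, mem_Ico]
    have h0 : k ≠ 0 := by
      rintro rfl
      have := hk.2
      rw [Nat.coprime_zero_right] at this
      omega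
    by_cases h1 : k = 1
    · exact Or.inl h1
    · exact Or.inr ⟨⟨by omega, hk.1⟩, hk.2.symm⟩
  exact (card_le_card this).trans (card_insert_le _ _)

end TotientLowerBound

/-! ### The fourth moment of binomial exponential sums -/

section FourthMoment

open Finset

variable {p : ℕ} [Fact p.Prime]

theorem sum_eq_zero_add_sum_units {M : Type*} [AddCommMonoid M] (h : ZMod p → M) :
    ∑ s, h s = h 0 + ∑ u : (ZMod p)ˣ, h u := by
  classical
  rw [← Finset.add_sum_erase univ h (mem_univ 0)]
  congr 1
  symm
  refine sum_bij (fun u _ => (u : ZMod p)) ?_ ?_ ?_ ?_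
  · intro u _; simp
  · intro u _ v _ h; exact Units.ext h
  · intro s hs; exact ⟨Units.mk0 s (by simpa using hs), mem_univ _, rfl⟩
  · intro u _; rfl

theorem sum_stdAddChar_mul (c : ZMod p) :
    ∑ a : ZMod p, ZMod.stdAddChar (a * c) = if c = 0 then (p : ℂ) else 0 := by
  rw [AddChar.sum_mulShift c (ZMod.isPrimitive_stdAddChar p), ZMod.card]
  split_ifs <;> simp

theorem norm_stdAddChar (a : ZMod p) : ‖(ZMod.stdAddChar a : ℂ)‖ = 1 :=
  AddChar.norm_apply _ a

/-- Parseval's identity for the exponential sum attached to a family of points of the plane. -/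
theorem sum_norm_sq_planeSum {ι : Type*} [Fintype ι] (A B : ι → ZMod p) :
    ∑ a : ZMod p, ∑ b : ZMod p, ‖∑ i, (ZMod.stdAddChar (a * A i + b * B i) : ℂ)‖ ^ 2
      = (p : ℝ) ^ 2 * #{q : ι × ι | A q.1 = A q.2 ∧ B q.1 = B q.2} := by
  have hC : ∑ a : ZMod p, ∑ b : ZMod p,
      ((‖∑ i, (ZMod.stdAddChar (a * A i + b * B i) : ℂ)‖ : ℂ)) ^ 2
      = (p : ℂ) ^ 2 * #{q : ι × ι | A q.1 = A q.2 ∧ B q.1 = B q.2} := by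
    have h1 : ∀ a b : ZMod p, ((‖∑ i, (ZMod.stdAddChar (a * A i + b * B i) : ℂ)‖ : ℂ)) ^ 2 =
        ∑ q : ι × ι, ZMod.stdAddChar (a * (A q.1 - A q.2)) *
          ZMod.stdAddChar (b * (B q.1 - B q.2)) := by
      intro a b
      rw [← Complex.mul_conj', map_sum, sum_mul_sum, Fintype.sum_prod_type]
      refine sum_congr rfl fun i _ => sum_congr rfl fun j _ => ?_
      rw [← AddChar.map_neg_eq_conj, ← AddChar.map_add_eq_mul, ← AddChar.map_add_eq_mul]
      congr 1
      ring
    simp only [h1]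
    calc _ = ∑ q : ι × ι, (∑ a : ZMod p, (ZMod.stdAddChar (a * (A q.1 - A q.2)) : ℂ)) *
          ∑ b : ZMod p, (ZMod.stdAddChar (b * (B q.1 - B q.2)) : ℂ) := by
          simp only [sum_mul_sum]
          exact (sum_congr rfl fun a _ => sum_comm).trans sum_comm
      _ = ∑ q : ι × ι, if A q.1 = A q.2 ∧ B q.1 = B q.2 then (p : ℂ) ^ 2 else 0 := by
          refine sum_congr rfl fun q _ => ?_
          rw [sum_stdAddChar_mul, sum_stdAddChar_mul, ite_and]
          simp only [sub_eq_zero]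
          split_ifs <;> ring
      _ = _ := by
          rw [← sum_filter, sum_const, nsmul_eq_mul, mul_comm]
  exact_mod_cast hC

/-- The sum of `ψ(a s ^ k + b s)` over the nonzero classes `s`. -/
noncomputable def binomialSum (p : ℕ) [Fact p.Prime] (k : ℕ) (a b : ZMod p) : ℂ :=
  ∑ s : (ZMod p)ˣ, ZMod.stdAddChar (a * (s : ZMod p) ^ k + b * (s : ZMod p))

/-- Substitute s ↦ b s in the sum on the right. -/
theorem binomialSum_unit (k : ℕ) (a : ZMod p) (b : (ZMod p)ˣ) :
    binomialSum p k a b = binomialSum p k (a * ((b⁻¹ ^ k : (ZMod p)ˣ) : ZMod p)) 1 := by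
  unfold binomialSum
  rw [← Equiv.sum_comp (Equiv.mulLeft b) (fun s : (ZMod p)ˣ => (ZMod.stdAddChar
    (a * ((b⁻¹ ^ k : (ZMod p)ˣ) : ZMod p) * (s : ZMod p) ^ k + 1 * (s : ZMod p)) : ℂ))]
  refine sum_congr rfl fun s _ => ?_
  congr 1
  have h : ((b⁻¹ ^ k : (ZMod p)ˣ) : ZMod p) * (b : ZMod p) ^ k = 1 := by
    rw [← Units.val_pow_eq_pow_val, ← Units.val_mul]; simp
  simp only [Equiv.coe_mulLeft, Units.val_mul, mul_pow]
  linear_combination (-a * (s : ZMod p) ^ k) * h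

/-- Both equations are homogeneous: dividing by the last variable w gives a coincidence, and w
together with that coincidence recovers the solution. -/
theorem card_energy_le (k : ℕ) :
    #{q : ((ZMod p)ˣ × (ZMod p)ˣ) × ((ZMod p)ˣ × (ZMod p)ˣ) |
      (q.1.1 : ZMod p) ^ k + (q.1.2 : ZMod p) ^ k = (q.2.1 : ZMod p) ^ k + (q.2.2 : ZMod p) ^ k ∧
      (q.1.1 : ZMod p) + q.1.2 = q.2.1 + q.2.2} ≤ (p - 1) * #(coincidences p k) := by
  have hU : #(univ : Finset (ZMod p)ˣ) = p - 1 := by rw [card_univ, ZMod.card_units]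
  rw [← hU, ← card_product]
  refine card_le_card_of_injOn
    (fun q => (q.2.2, q.1.1 / q.2.2, q.1.2 / q.2.2, q.2.1 / q.2.2)) ?_ ?_
  · rintro ⟨⟨x, y⟩, z, w⟩ h
    simp only [coe_filter, mem_univ, true_and, Set.mem_ofPred_eq] at h
    have hw : (w : ZMod p) ≠ 0 := w.ne_zero
    simp only [coe_product, coe_univ, Set.mem_prod, Set.mem_univ, true_and, coincidences,
      coe_filter, mem_univ, Set.mem_ofPred_eq, Units.val_div_eq_div_val, div_pow]
    constructor
    · field_simp; exact h.2
    · field_simp; exact h.1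
  · rintro ⟨⟨x, y⟩, z, w⟩ _ ⟨⟨x', y'⟩, z', w'⟩ _ h
    simp only [Prod.mk.injEq] at h ⊢
    obtain ⟨rfl, h1, h2, h3⟩ := h
    exact ⟨⟨div_left_injective h1, div_left_injective h2⟩, div_left_injective h3, rfl⟩

/-- By Parseval, the fourth moment over all (a, b) is p² times the energy. Each of the p - 1 values
b ≠ 0 contributes the same one-parameter moment, which cancels the factor p - 1 of `card_energy_le`.
-/
theorem sum_norm_binomialSum_pow_four_le (hp : 3 ≤ p) (k : ℕ) :
    ∑ t : ZMod p, ‖binomialSum p k t 1‖ ^ 4 ≤ (p : ℝ) ^ 2 * #(coincidences p k) := by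
  have hsq : ∀ a b : ZMod p, ‖binomialSum p k a b‖ ^ 4 =
      ‖∑ i : (ZMod p)ˣ × (ZMod p)ˣ, (ZMod.stdAddChar (a * ((i.1 : ZMod p) ^ k + (i.2 : ZMod p) ^ k)
        + b * ((i.1 : ZMod p) + (i.2 : ZMod p))) : ℂ)‖ ^ 2 := by
    intro a b
    rw [show (4 : ℕ) = 2 * 2 by norm_num, pow_mul, ← norm_pow, sq (binomialSum p k a b)]
    congr 2
    unfold binomialSum
    rw [sum_mul_sum, Fintype.sum_prod_type]
    refine sum_congr rfl fun i _ => sum_congr rfl fun j _ => ?_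
    rw [← AddChar.map_add_eq_mul]
    congr 1
    ring
  have hunit : ∀ b : (ZMod p)ˣ, ∑ a : ZMod p, ‖binomialSum p k a b‖ ^ 4 =
      ∑ t : ZMod p, ‖binomialSum p k t 1‖ ^ 4 := by
    intro b
    simp only [binomialSum_unit k _ b]
    exact Equiv.sum_comp (b⁻¹ ^ k).mulRight (fun t => ‖binomialSum p k t 1‖ ^ 4)
  have htotal := sum_norm_sq_planeSum (p := p)
    (fun i : (ZMod p)ˣ × (ZMod p)ˣ => (i.1 : ZMod p) ^ k + (i.2 : ZMod p) ^ k)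
    (fun i => (i.1 : ZMod p) + (i.2 : ZMod p))
  simp only [← hsq] at htotal
  have hle : ((p - 1 : ℕ) : ℝ) * ∑ t : ZMod p, ‖binomialSum p k t 1‖ ^ 4 ≤
      (p : ℝ) ^ 2 * (((p - 1) * #(coincidences p k) : ℕ) : ℝ) := by
    calc _ = ∑ b : (ZMod p)ˣ, ∑ a : ZMod p, ‖binomialSum p k a b‖ ^ 4 := by
          simp only [hunit, sum_const, card_univ, ZMod.card_units, nsmul_eq_mul]
      _ ≤ ∑ b : ZMod p, ∑ a : ZMod p, ‖binomialSum p k a b‖ ^ 4 := by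
          rw [sum_eq_zero_add_sum_units (fun b => ∑ a : ZMod p, ‖binomialSum p k a b‖ ^ 4)]
          exact le_add_of_nonneg_left (by positivity)
      _ = _ := by rw [sum_comm, htotal]
      _ ≤ _ := by gcongr; exact card_energy_le k
  have hp0 : (0 : ℝ) < ((p - 1 : ℕ) : ℝ) := by exact_mod_cast (by omega : 0 < p - 1)
  rw [Nat.cast_mul, mul_left_comm] at hle
  exact le_of_mul_le_mul_left hle hp0

end FourthMoment

/-! ### Fourier coefficients of intervals -/

section IntervalFourier

open Finset

variable {p : ℕ} [Fact p.Prime]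

/-- An integer interval containing both x and x + n covers every class. Otherwise it is bounded and
reduction is injective on it. -/
theorem IsModInterval.eq_univ_or_exists {n : ℕ} [NeZero n] {S : Set (ZMod n)}
    (hS : IsModInterval S) : S = Set.univ ∨ ∃ (c : ℤ) (l : ℕ),
      Set.InjOn (fun i : ℕ => ((c + i : ℤ) : ZMod n)) (Set.Iio l) ∧
      S = (fun i : ℕ => ((c + i : ℤ) : ZMod n)) '' Set.Iio l := by
  obtain ⟨I, hI, rfl⟩ := hS
  have hn : (0 : ℤ) < n := by exact_mod_cast NeZero.pos n
  by_cases hlong : ∃ x ∈ I, x + n ∈ I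
  · left
    obtain ⟨x, hx, hxn⟩ := hlong
    refine Set.eq_univ_of_forall fun s => ?_
    refine ⟨x + ((s.val : ℤ) - x) % n, hI.out hx hxn ⟨?_, ?_⟩, ?_⟩
    · have := Int.emod_nonneg ((s.val : ℤ) - x) hn.ne'; omega
    · have := Int.emod_lt_of_pos ((s.val : ℤ) - x) hn; omega
    · simp
  · right
    push Not at hlong
    have hinj : ∀ x ∈ I, ∀ y ∈ I, ((x : ℤ) : ZMod n) = (y : ZMod n) → x ≤ y → x = y := by
      intro x hx y hy hxy hle
      by_contra hne
      rw [ZMod.intCast_eq_intCast_iff_dvd_sub] at hxy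
      have := Int.le_of_dvd (by omega) hxy
      exact hlong x hx (hI.out hx hy ⟨by omega, by omega⟩)
    rcases I.eq_empty_or_nonempty with rfl | ⟨c, hc⟩
    · exact ⟨0, 0, by simp, by simp⟩
    have hfin : I.Finite := by
      refine (Set.finite_Ioo (c - n) (c + n)).subset fun y hy => ⟨?_, ?_⟩
      · by_contra h
        exact hlong (c - n) (hI.out hy hc ⟨by omega, by omega⟩) (by simpa using hc)
      · by_contra h
        exact hlong c hc (hI.out hc hy ⟨by omega, by omega⟩)
    obtain ⟨lo, hlo, hmin⟩ := hfin.exists_minimal ⟨c, hc⟩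
    obtain ⟨hi, hhi, hmax⟩ := hfin.exists_maximal ⟨c, hc⟩
    have hminle : ∀ y ∈ I, lo ≤ y := fun y hy => (le_total lo y).elim id (hmin hy)
    have hmaxle : ∀ y ∈ I, y ≤ hi := fun y hy => (le_total y hi).elim id (hmax hy)
    have hIeq : I = (fun i : ℕ => lo + (i : ℤ)) '' Set.Iio (hi + 1 - lo).toNat := by
      ext y
      constructor
      · intro hy
        have := hminle y hy
        have := hmaxle y hy
        exact ⟨(y - lo).toNat, by simp only [Set.mem_Iio]; omega, by dsimp only; omega⟩
      · rintro ⟨i, hi', rfl⟩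
        simp only [Set.mem_Iio] at hi'
        exact hI.out hlo hhi ⟨by dsimp only; omega, by dsimp only; omega⟩
    refine ⟨lo, (hi + 1 - lo).toNat, ?_, ?_⟩
    · intro i hi' j hj hij
      have hiI : lo + (i : ℤ) ∈ I := by rw [hIeq]; exact ⟨i, hi', rfl⟩
      have hjI : lo + (j : ℤ) ∈ I := by rw [hIeq]; exact ⟨j, hj, rfl⟩
      rcases le_total (lo + (i : ℤ)) (lo + j) with h | h
      · have := hinj _ hiI _ hjI hij h; omega
      · have := hinj _ hjI _ hiI hij.symm h; omega
    · conv_lhs => rw [hIeq]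
      rw [Set.image_image]

/-- The reciprocal of the distance from `b` to `0` in `ℤ/pℤ`. -/
noncomputable def invDist {n : ℕ} (b : ZMod n) : ℝ := |(b.valMinAbs : ℝ)|⁻¹

theorem invDist_nonneg {n : ℕ} (b : ZMod n) : 0 ≤ invDist b := by unfold invDist; positivity

theorem invDist_neg {n : ℕ} (b : ZMod n) : invDist (-b) = invDist b := by
  unfold invDist
  rw [← Int.cast_abs, ← Int.cast_abs, Int.abs_eq_natAbs, Int.abs_eq_natAbs,
    ZMod.natAbs_valMinAbs_neg]

/-- |e(θ) - 1| = 2|sin πθ| ≥ 4|θ| for |θ| ≤ 1/2, by Jordan's inequality. -/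
theorem le_norm_stdAddChar_sub_one (b : ZMod p) :
    4 * |(b.valMinAbs : ℝ)| / p ≤ ‖(ZMod.stdAddChar b : ℂ) - 1‖ := by
  have hp0 : (0 : ℝ) < p := by exact_mod_cast (Fact.out : p.Prime).pos
  set j := b.valMinAbs with hj
  have hb : (ZMod.stdAddChar b : ℂ) = Complex.exp (Complex.I * ((2 * (Real.pi * j / p) : ℝ) : ℂ)) := by
    conv_lhs => rw [← ZMod.coe_valMinAbs b]
    rw [ZMod.stdAddChar_coe]
    congr 1
    push_cast
    ring
  rw [hb, Complex.norm_exp_I_mul_ofReal_sub_one, mul_div_cancel_left₀ _ (two_ne_zero), norm_mul,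
    Real.norm_two, Real.norm_eq_abs]
  have hjle : |(j : ℝ)| ≤ p / 2 := by
    have h1 := ZMod.natAbs_valMinAbs_le b
    have h2 : j.natAbs * 2 ≤ p := by omega
    have h3 : |(j : ℝ)| = (j.natAbs : ℝ) := by
      rw [← Int.cast_abs, Int.abs_eq_natAbs]; simp
    rw [h3, le_div_iff₀ two_pos]
    exact_mod_cast h2
  have habs : |Real.pi * j / p| = Real.pi * |(j : ℝ)| / p := by
    rw [abs_div, abs_mul, abs_of_pos Real.pi_pos, abs_of_pos hp0]
  have hx2 : Real.pi * |(j : ℝ)| / p ≤ Real.pi / 2 := by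
    rw [div_le_div_iff₀ hp0 two_pos]
    nlinarith [Real.pi_pos]
  have hsin : Real.sin (Real.pi * |(j : ℝ)| / p) ≤ |Real.sin (Real.pi * j / p)| := by
    rcases abs_choice (j : ℝ) with h | h
    · rw [h]; exact le_abs_self _
    · rw [h, mul_neg, neg_div, Real.sin_neg]; exact neg_le_abs _
  have hJ := Real.mul_le_sin (x := Real.pi * |(j : ℝ)| / p) (by positivity) hx2
  have : 2 / Real.pi * (Real.pi * |(j : ℝ)| / p) = 2 * |(j : ℝ)| / p := by
    field_simp
  rw [this] at hJ
  calc 4 * |(j : ℝ)| / p = 2 * (2 * |(j : ℝ)| / p) := by ring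
    _ ≤ _ := by gcongr; exact hJ.trans hsin

/-- For a proper interval this is a geometric sum with numerator at most 2; over the whole group the
sum vanishes. -/
theorem norm_sum_interval_le {A : Finset (ZMod p)} (hA : IsModInterval (A : Set (ZMod p)))
    {b : ZMod p} (hb : b ≠ 0) :
    ‖∑ x ∈ A, (ZMod.stdAddChar (b * x) : ℂ)‖ ≤ p / 2 * invDist b := by
  have hp0 : (0 : ℝ) < p := by exact_mod_cast (Fact.out : p.Prime).pos
  rcases hA.eq_univ_or_exists with h | ⟨c, l, hinj, h⟩
  · rw [Finset.coe_eq_univ] at h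
    have := sum_stdAddChar_mul b
    simp only [hb, if_false] at this
    simp only [h, mul_comm b, this, norm_zero]
    exact mul_nonneg (by positivity) (invDist_nonneg b)
  · have hA' : A = (range l).image (fun i : ℕ => ((c + i : ℤ) : ZMod p)) := by
      apply Finset.coe_injective
      rw [h, coe_image, coe_range]
    have hsum : ∑ x ∈ A, (ZMod.stdAddChar (b * x) : ℂ) =
        ZMod.stdAddChar (b * (c : ZMod p)) * ∑ i ∈ range l, (ZMod.stdAddChar b : ℂ) ^ i := by
      rw [hA', sum_image (by rw [coe_range]; exact hinj), mul_sum]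
      refine sum_congr rfl fun i _ => ?_
      rw [← AddChar.map_nsmul_eq_pow, ← AddChar.map_add_eq_mul]
      congr 1
      push_cast
      rw [nsmul_eq_mul]
      ring
    have hv : 0 < |(b.valMinAbs : ℝ)| := by
      rw [abs_pos, Int.cast_ne_zero]
      simpa using hb
    have hlow := le_norm_stdAddChar_sub_one b
    have hpos : 0 < ‖(ZMod.stdAddChar b : ℂ) - 1‖ := lt_of_lt_of_le (by positivity) hlow
    have hne : (ZMod.stdAddChar b : ℂ) ≠ 1 := fun h => by simp [h] at hpos
    rw [hsum, norm_mul, norm_stdAddChar, one_mul, geom_sum_eq hne, norm_div, div_le_iff₀ hpos]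
    have hnum : ‖(ZMod.stdAddChar b : ℂ) ^ l - 1‖ ≤ 2 := by
      refine (norm_sub_le _ _).trans ?_
      rw [norm_pow, norm_stdAddChar]; norm_num
    calc _ ≤ (2 : ℝ) := hnum
      _ = p / 2 * invDist b * (4 * |(b.valMinAbs : ℝ)| / p) := by
          unfold invDist; field_simp; norm_num
      _ ≤ _ := by
          have := invDist_nonneg b
          gcongr

end IntervalFourier

/-! ### From the fourth moment to the discrepancy -/

section DiscrepancyBound

open Finset

variable {p : ℕ} [Fact p.Prime]

theorem sum_sum_stdAddChar_sub (A : Finset (ZMod p)) (s : ZMod p) :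
    ∑ b : ZMod p, ∑ x ∈ A, (ZMod.stdAddChar (b * (s - x)) : ℂ) = if s ∈ A then (p : ℂ) else 0 := by
  rw [sum_comm]
  simp only [sum_stdAddChar_mul, sub_eq_zero, sum_ite_eq]

/-- Fourier inversion of the indicators of `A` at s and of `B` at σ s, summed over s. -/
theorem sum_fourier_perm (σ : Equiv.Perm (ZMod p)) (A B : Finset (ZMod p)) :
    ∑ a : ZMod p, ∑ b : ZMod p, (∑ y ∈ B, (ZMod.stdAddChar (-a * y) : ℂ)) *
      (∑ x ∈ A, (ZMod.stdAddChar (-b * x) : ℂ)) * ∑ s, (ZMod.stdAddChar (a * σ s + b * s) : ℂ)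
      = (p : ℂ) ^ 2 * #{s ∈ A | σ s ∈ B} := by
  have h1 : ∀ a b : ZMod p, (∑ y ∈ B, (ZMod.stdAddChar (-a * y) : ℂ)) *
      (∑ x ∈ A, (ZMod.stdAddChar (-b * x) : ℂ)) * ∑ s, (ZMod.stdAddChar (a * σ s + b * s) : ℂ)
      = ∑ s, (∑ y ∈ B, (ZMod.stdAddChar (a * (σ s - y)) : ℂ)) *
        ∑ x ∈ A, (ZMod.stdAddChar (b * (s - x)) : ℂ) := by
    intro a b
    rw [mul_sum]
    refine sum_congr rfl fun s _ => ?_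
    have e1 : ∀ y : ZMod p, (ZMod.stdAddChar (a * (σ s - y)) : ℂ) =
        ZMod.stdAddChar (-a * y) * ZMod.stdAddChar (a * σ s) := fun y => by
      rw [← AddChar.map_add_eq_mul]; congr 1; ring
    have e2 : ∀ x : ZMod p, (ZMod.stdAddChar (b * (s - x)) : ℂ) =
        ZMod.stdAddChar (-b * x) * ZMod.stdAddChar (b * s) := fun x => by
      rw [← AddChar.map_add_eq_mul]; congr 1; ring
    simp only [e1, e2, ← sum_mul, AddChar.map_add_eq_mul]
    ring
  simp only [h1]
  calc _ = ∑ s, (∑ a : ZMod p, ∑ y ∈ B, (ZMod.stdAddChar (a * (σ s - y)) : ℂ)) *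
        ∑ b : ZMod p, ∑ x ∈ A, (ZMod.stdAddChar (b * (s - x)) : ℂ) := by
        refine ((sum_congr rfl fun a _ => sum_comm).trans sum_comm).trans ?_
        exact sum_congr rfl fun s _ => (sum_mul_sum _ _ _ _).symm
    _ = ∑ s, if s ∈ A ∧ σ s ∈ B then (p : ℂ) ^ 2 else 0 := by
        refine sum_congr rfl fun s _ => ?_
        rw [sum_sum_stdAddChar_sub, sum_sum_stdAddChar_sub, ite_and]
        split_ifs <;> ring
    _ = _ := by
        rw [← sum_filter, sum_const, nsmul_eq_mul, mul_comm]
        congr 3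
        ext s
        simp

theorem setDiscrepancy_perm_le (σ : Equiv.Perm (ZMod p)) {A B : Finset (ZMod p)}
    (hA : IsModInterval (A : Set (ZMod p))) (hB : IsModInterval (B : Set (ZMod p))) :
    setDiscrepancy (B : Set (ZMod p)) (σ '' A) ≤
      1 / 4 * ∑ a : (ZMod p)ˣ, ∑ b : (ZMod p)ˣ, invDist (a : ZMod p) * invDist (b : ZMod p) *
        ‖∑ s, (ZMod.stdAddChar ((a : ZMod p) * σ s + (b : ZMod p) * s) : ℂ)‖ := by
  have hp0 : (0 : ℝ) < p := by exact_mod_cast (Fact.out : p.Prime).pos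
  have hpC : (p : ℂ) ≠ 0 := by exact_mod_cast hp0.ne'
  set N := #{s ∈ A | σ s ∈ B} with hN
  have hinter : ((σ '' (A : Set (ZMod p))) ∩ B).ncard = N := by
    have : (σ '' (A : Set (ZMod p))) ∩ B = σ '' ({s ∈ A | σ s ∈ B} : Finset (ZMod p)) := by
      ext y
      simp only [Set.mem_inter_iff, Set.mem_image, mem_coe, mem_filter]
      constructor
      · rintro ⟨⟨s, hs, rfl⟩, hy⟩; exact ⟨s, ⟨hs, hy⟩, rfl⟩
      · rintro ⟨s, ⟨hs, hy⟩, rfl⟩; exact ⟨⟨s, hs, rfl⟩, hy⟩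
    rw [this, Set.ncard_image_of_injective _ σ.injective, Set.ncard_coe_finset]
  have himage : (σ '' (A : Set (ZMod p))).ncard = #A := by
    rw [Set.ncard_image_of_injective _ σ.injective, Set.ncard_coe_finset]
  unfold setDiscrepancy
  rw [hinter, himage, Set.ncard_coe_finset]
  have hzero : ∀ u : (ZMod p)ˣ, ∑ s, (ZMod.stdAddChar ((u : ZMod p) * s) : ℂ) = 0 := fun u => by
    have := sum_stdAddChar_mul (u : ZMod p)
    simpa [mul_comm] using this
  have hzero' : ∀ u : (ZMod p)ˣ, ∑ s, (ZMod.stdAddChar ((u : ZMod p) * σ s) : ℂ) = 0 := fun u =>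
    (Equiv.sum_comp σ (fun s => (ZMod.stdAddChar ((u : ZMod p) * s) : ℂ))).trans (hzero u)
  have hF := sum_fourier_perm σ A B
  rw [sum_eq_zero_add_sum_units] at hF
  simp only [sum_eq_zero_add_sum_units (p := p) (M := ℂ) (h := fun b => _ * (∑ x ∈ A,
    (ZMod.stdAddChar (-b * x) : ℂ)) * ∑ s, (ZMod.stdAddChar (_ + b * s) : ℂ))] at hF
  -- The frequency (0, 0) gives the main term p|A||B|; frequencies with exactly one zero entry
  -- vanish because σ is a bijection.
  simp only [neg_zero, zero_mul, zero_add, add_zero, AddChar.map_zero_eq_one, sum_const,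
    nsmul_eq_mul, mul_one, hzero, hzero', mul_zero, card_univ, ZMod.card] at hF
  set E : ℂ := ∑ a : (ZMod p)ˣ, ∑ b : (ZMod p)ˣ, (∑ y ∈ B, (ZMod.stdAddChar (-(a : ZMod p) * y) : ℂ)) *
      (∑ x ∈ A, (ZMod.stdAddChar (-(b : ZMod p) * x) : ℂ)) *
        ∑ s, (ZMod.stdAddChar ((a : ZMod p) * σ s + (b : ZMod p) * s) : ℂ) with hE
  have hEq : (((N : ℝ) - #A * #B / p : ℝ) : ℂ) = E / (p : ℂ) ^ 2 := by
    rw [eq_div_iff (by positivity)]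
    push_cast
    field_simp
    linear_combination -hF
  have hEnorm : ‖E‖ ≤ ∑ a : (ZMod p)ˣ, ∑ b : (ZMod p)ˣ, (p / 2 * invDist (a : ZMod p)) *
      (p / 2 * invDist (b : ZMod p)) * ‖∑ s, (ZMod.stdAddChar ((a : ZMod p) * σ s + (b : ZMod p) * s) : ℂ)‖ := by
    refine (norm_sum_le _ _).trans (sum_le_sum fun a _ => (norm_sum_le _ _).trans
      (sum_le_sum fun b _ => ?_))
    rw [norm_mul, norm_mul]
    have ha := norm_sum_interval_le hB (b := -(a : ZMod p)) (neg_ne_zero.mpr a.ne_zero)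
    have hb := norm_sum_interval_le hA (b := -(b : ZMod p)) (neg_ne_zero.mpr b.ne_zero)
    rw [invDist_neg] at ha hb
    gcongr
    exact (norm_nonneg _).trans ha
  calc |(N : ℝ) - #A * #B / p| = ‖(((N : ℝ) - #A * #B / p : ℝ) : ℂ)‖ := by
        rw [Complex.norm_real, Real.norm_eq_abs]
    _ = ‖E‖ / (p : ℝ) ^ 2 := by rw [hEq, norm_div, norm_pow, Complex.norm_natCast]
    _ ≤ _ := by
        rw [div_le_iff₀ (by positivity)]
        refine hEnorm.trans (le_of_eq ?_)
        rw [mul_sum, sum_mul]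
        refine sum_congr rfl fun a _ => ?_
        rw [mul_sum, sum_mul]
        refine sum_congr rfl fun b _ => ?_
        ring

theorem sum_invDist_rpow_le {s : ℝ} (hs : 1 < s) :
    ∑ u : (ZMod p)ˣ, invDist (u : ZMod p) ^ s ≤ ∑' z : ℤ, |(z : ℝ)| ^ (-s) := by
  have hinj : Function.Injective fun u : (ZMod p)ˣ => (u : ZMod p).valMinAbs :=
    ZMod.injective_valMinAbs.comp Units.val_injective
  calc ∑ u : (ZMod p)ˣ, invDist (u : ZMod p) ^ s
      = ∑ u : (ZMod p)ˣ, |(((u : ZMod p).valMinAbs : ℤ) : ℝ)| ^ (-s) := by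
        refine sum_congr rfl fun u _ => ?_
        rw [invDist, Real.inv_rpow (abs_nonneg _), Real.rpow_neg (abs_nonneg _)]
    _ = ∑ z ∈ univ.map ⟨_, hinj⟩, |(z : ℝ)| ^ (-s) := by rw [sum_map]; rfl
    _ ≤ _ := (Real.summable_abs_int_rpow hs).sum_le_tsum _ fun z _ => by positivity

/-- A weighted sum over the orbits of the action of a group on itself through multiplication and
the `k`-th power map is bounded by the fourth moment. -/
theorem sum_weight_mul_le {G : Type*} [CommGroup G] [Fintype G] {k : ℕ}
    (hk : Function.Bijective fun u : G => u ^ k) (a : G) {w g : G → ℝ} (hw : ∀ u, 0 ≤ w u)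
    (hg : ∀ u, 0 ≤ g u) :
    ∑ u, ∑ v, w u * w v * g (u * a * v⁻¹ ^ k) ≤
      ((∑ u, w u ^ (3 / 2 : ℝ)) * ∑ t, g t ^ 4) ^ (1 / 4 : ℝ) *
        ((∑ u, w u ^ (13 / 12 : ℝ)) ^ 2) ^ (3 / 4 : ℝ) := by
  -- The split 3/16 + 13/16 makes the final weight exponents 4 · 3/16 · 2 = 3/2 and 13/16 · 4/3 =
  -- 13/12. Both exceed 1, so with w = 1/|u| the weight sums stay bounded and no logarithm appears.
  have hsplit : ∀ x : ℝ, 0 ≤ x → x = x ^ (3 / 16 : ℝ) * x ^ (13 / 16 : ℝ) := fun x hx => by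
    rw [← Real.rpow_add_of_nonneg hx (by norm_num) (by norm_num)]; norm_num
  have hH := Real.inner_le_Lp_mul_Lq_of_nonneg (univ : Finset (G × G))
    (f := fun q => (w q.1 * w q.2) ^ (3 / 16 : ℝ) * g (q.1 * a * q.2⁻¹ ^ k))
    (g := fun q => (w q.1 * w q.2) ^ (13 / 16 : ℝ)) (p := 4) (q := 4 / 3)
    (by rw [Real.holderConjugate_iff]; norm_num)
    (fun q _ => mul_nonneg (Real.rpow_nonneg (mul_nonneg (hw _) (hw _)) _) (hg _))
    (fun q _ => Real.rpow_nonneg (mul_nonneg (hw _) (hw _)) _)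
  have h1 : ∑ u, ∑ v, w u * w v * g (u * a * v⁻¹ ^ k) =
      ∑ q : G × G, (w q.1 * w q.2) ^ (3 / 16 : ℝ) * g (q.1 * a * q.2⁻¹ ^ k) *
        (w q.1 * w q.2) ^ (13 / 16 : ℝ) := by
    rw [Fintype.sum_prod_type]
    refine sum_congr rfl fun u _ => sum_congr rfl fun v _ => ?_
    conv_lhs => rw [hsplit _ (mul_nonneg (hw u) (hw v))]
    ring
  have h2 : ∑ q : G × G, ((w q.1 * w q.2) ^ (3 / 16 : ℝ) * g (q.1 * a * q.2⁻¹ ^ k)) ^ (4 : ℝ) ≤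
      (∑ u, w u ^ (3 / 2 : ℝ)) * ∑ t, g t ^ 4 := by
    -- The arithmetic-geometric mean inequality decouples the two weights; the free variable then
    -- makes the argument of g run once over the whole group.
    have hpt : ∀ q : G × G, ((w q.1 * w q.2) ^ (3 / 16 : ℝ) * g (q.1 * a * q.2⁻¹ ^ k)) ^ (4 : ℝ) ≤
        1 / 2 * (w q.1 ^ (3 / 2 : ℝ) * g (q.1 * a * q.2⁻¹ ^ k) ^ 4) +
        1 / 2 * (w q.2 ^ (3 / 2 : ℝ) * g (q.1 * a * q.2⁻¹ ^ k) ^ 4) := by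
      intro q
      have hw0 := mul_nonneg (hw q.1) (hw q.2)
      rw [Real.mul_rpow (Real.rpow_nonneg hw0 _) (hg _), ← Real.rpow_mul hw0,
        show (4 : ℝ) = (4 : ℕ) by norm_num, Real.rpow_natCast,
        show (3 / 16 * (4 : ℕ) : ℝ) = 3 / 4 by norm_num, Real.mul_rpow (hw _) (hw _)]
      have hs : ∀ x : ℝ, 0 ≤ x → x ^ (3 / 2 : ℝ) = (x ^ (3 / 4 : ℝ)) ^ 2 := fun x hx => by
        rw [← Real.rpow_natCast, ← Real.rpow_mul hx]; norm_num
      rw [hs _ (hw _), hs _ (hw _)]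
      have := two_mul_le_add_sq (w q.1 ^ (3 / 4 : ℝ)) (w q.2 ^ (3 / 4 : ℝ))
      have hg4 : 0 ≤ g (q.1 * a * q.2⁻¹ ^ k) ^ 4 := by positivity
      nlinarith
    have hs1 : ∑ q : G × G, w q.1 ^ (3 / 2 : ℝ) * g (q.1 * a * q.2⁻¹ ^ k) ^ 4 =
        (∑ u, w u ^ (3 / 2 : ℝ)) * ∑ t, g t ^ 4 := by
      rw [Fintype.sum_prod_type, sum_mul]
      refine sum_congr rfl fun u _ => ?_
      dsimp only
      rw [← mul_sum]
      congr 1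
      exact Equiv.sum_comp ((Equiv.inv G).trans ((Equiv.ofBijective _ hk).trans
        (Equiv.mulLeft (u * a)))) (fun t => g t ^ 4)
    have hs2 : ∑ q : G × G, w q.2 ^ (3 / 2 : ℝ) * g (q.1 * a * q.2⁻¹ ^ k) ^ 4 =
        (∑ u, w u ^ (3 / 2 : ℝ)) * ∑ t, g t ^ 4 := by
      rw [Fintype.sum_prod_type_right, sum_mul]
      refine sum_congr rfl fun v _ => ?_
      dsimp only
      rw [← mul_sum]
      congr 1
      exact Equiv.sum_comp ((Equiv.mulRight a).trans (Equiv.mulRight (v⁻¹ ^ k)))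
        (fun t => g t ^ 4)
    calc _ ≤ _ := sum_le_sum fun q _ => hpt q
      _ = _ := by
        rw [sum_add_distrib, ← mul_sum, ← mul_sum, hs1, hs2]; ring
  have h3 : ∑ q : G × G, ((w q.1 * w q.2) ^ (13 / 16 : ℝ)) ^ (4 / 3 : ℝ) =
      (∑ u, w u ^ (13 / 12 : ℝ)) ^ 2 := by
    rw [sq, sum_mul_sum, Fintype.sum_prod_type]
    refine sum_congr rfl fun u _ => sum_congr rfl fun v _ => ?_
    rw [← Real.rpow_mul (mul_nonneg (hw u) (hw v)), ← Real.mul_rpow (hw u) (hw v)]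
    norm_num
  rw [h1]
  refine hH.trans ?_
  rw [h3, show (1 / (4 / 3) : ℝ) = 3 / 4 by norm_num]
  refine mul_le_mul_of_nonneg_right ?_ (by positivity)
  refine Real.rpow_le_rpow (sum_nonneg fun q _ => ?_) h2 (by norm_num)
  exact Real.rpow_nonneg (mul_nonneg (Real.rpow_nonneg (mul_nonneg (hw _) (hw _)) _) (hg _)) _

theorem exists_permDiscrepancy_le : ∃ C : ℝ, 0 < C ∧ ∀ (p : ℕ) [Fact p.Prime], 3 ≤ p →
    ∀ (a : (ZMod p)ˣ) (k : powerExponents p), permDiscrepancy (powerPerm p a k) ≤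
      C * ((p : ℝ) + (p : ℝ) ^ 2 * #(coincidences p k)) ^ (1 / 4 : ℝ) := by
  set S : ℝ := ∑' z : ℤ, |(z : ℝ)| ^ (-(3 / 2) : ℝ)
  set S' : ℝ := ∑' z : ℤ, |(z : ℝ)| ^ (-(13 / 12) : ℝ)
  have hS : 0 ≤ S := tsum_nonneg fun e => by positivity
  have hS' : 0 ≤ S' := tsum_nonneg fun e => by positivity
  -- The summand 1 only makes the constant visibly positive.
  refine ⟨1 / 4 * ((S * 8) ^ (1 / 4 : ℝ) * (S' ^ 2) ^ (3 / 4 : ℝ)) + 1, by positivity,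
    fun p _ hp a k => ?_⟩
  set M : ℝ := (p : ℝ) + (p : ℝ) ^ 2 * #(coincidences p k) with hM
  have hM0 : 0 ≤ M := by positivity
  obtain ⟨I, J, hI, hJ, hd⟩ := (permDiscrepancy_isGreatest (powerPerm p a k)).1
  rw [hd]
  classical
  have hIc := Set.coe_toFinset I
  have hJc := Set.coe_toFinset J
  have hmain := setDiscrepancy_perm_le (powerPerm p a k) (A := I.toFinset) (B := J.toFinset)
    (by rwa [hIc]) (by rwa [hJc])
  rw [hIc, hJc] at hmain
  have hkmem := k.2
  simp only [powerExponents, mem_filter, mem_Ico] at hkmem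
  have hk0 : (k : ℕ) ≠ 0 := by omega
  -- The 1 accounts for the class s = 0, absent from `binomialSum`; it produces the summand p in
  -- `M`.
  set g : (ZMod p)ˣ → ℝ := fun t => 1 + ‖binomialSum p k t 1‖ with hg
  have hbij : Function.Bijective fun u : (ZMod p)ˣ => u ^ (k : ℕ) := by
    refine (powCoprime (G := (ZMod p)ˣ) (n := (k : ℕ)) ?_).bijective
    rw [Nat.card_eq_fintype_card, ZMod.card_units]
    exact hkmem.2.symm
  have hnorm : ∀ u v : (ZMod p)ˣ, ‖∑ s, (ZMod.stdAddChar ((u : ZMod p) * powerPerm p a k s + (v : ZMod p) * s) : ℂ)‖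
      ≤ g (u * a * v⁻¹ ^ (k : ℕ)) := by
    intro u v
    have h : ∑ s, (ZMod.stdAddChar ((u : ZMod p) * powerPerm p a k s + (v : ZMod p) * s) : ℂ) =
        1 + binomialSum p k ((u * a : (ZMod p)ˣ) : ZMod p) v := by
      rw [sum_eq_zero_add_sum_units]
      simp only [powerPerm, Equiv.ofBijective_apply, binomialSum, zero_pow hk0, mul_zero, add_zero,
        AddChar.map_zero_eq_one, Units.val_mul, mul_assoc]
    rw [h, binomialSum_unit, ← Units.val_mul]
    refine (norm_add_le _ _).trans ?_
    rw [norm_one]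
  have hg4 : ∑ t, g t ^ 4 ≤ 8 * M := by
    calc ∑ t, g t ^ 4 ≤ ∑ t : (ZMod p)ˣ, 8 * (1 + ‖binomialSum p k t 1‖ ^ 4) := by
          refine sum_le_sum fun t _ => ?_
          have := add_pow_le zero_le_one (norm_nonneg (binomialSum p k t 1)) 4
          norm_num at this
          exact this
      _ = 8 * (((p - 1 : ℕ) : ℝ) + ∑ t : (ZMod p)ˣ, ‖binomialSum p k t 1‖ ^ 4) := by
          rw [← mul_sum, sum_add_distrib]
          rw [sum_const, nsmul_one, card_univ, ZMod.card_units]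
      _ ≤ 8 * M := by
          have h1 := sum_norm_binomialSum_pow_four_le hp k
          rw [sum_eq_zero_add_sum_units] at h1
          have h2 : 0 ≤ ‖binomialSum p k 0 1‖ ^ 4 := by positivity
          have h3 : ((p - 1 : ℕ) : ℝ) ≤ p := by exact_mod_cast Nat.sub_le _ _
          rw [hM]
          linarith
  have hw : ∀ u : (ZMod p)ˣ, 0 ≤ invDist (u : ZMod p) := fun u => invDist_nonneg _
  have hgn : ∀ t, 0 ≤ g t := fun t => by positivity
  calc _ ≤ _ := hmain
    _ ≤ 1 / 4 * ∑ u : (ZMod p)ˣ, ∑ v : (ZMod p)ˣ, invDist (u : ZMod p) * invDist (v : ZMod p) *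
        g (u * a * v⁻¹ ^ (k : ℕ)) := by
        gcongr with u _ v _
        · exact mul_nonneg (hw u) (hw v)
        · exact hnorm u v
    _ ≤ 1 / 4 * ((S * (8 * M)) ^ (1 / 4 : ℝ) * (S' ^ 2) ^ (3 / 4 : ℝ)) := by
        refine mul_le_mul_of_nonneg_left ((sum_weight_mul_le hbij a hw hgn).trans ?_) (by norm_num)
        have h1 : ∑ u : (ZMod p)ˣ, invDist (u : ZMod p) ^ (3 / 2 : ℝ) ≤ S :=
          sum_invDist_rpow_le (by norm_num)
        have h2 : ∑ u : (ZMod p)ˣ, invDist (u : ZMod p) ^ (13 / 12 : ℝ) ≤ S' :=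
          sum_invDist_rpow_le (by norm_num)
        have h3 : 0 ≤ ∑ u : (ZMod p)ˣ, invDist (u : ZMod p) ^ (3 / 2 : ℝ) :=
          sum_nonneg fun u _ => Real.rpow_nonneg (hw u) _
        have h4 : 0 ≤ ∑ u : (ZMod p)ˣ, invDist (u : ZMod p) ^ (13 / 12 : ℝ) :=
          sum_nonneg fun u _ => Real.rpow_nonneg (hw u) _
        gcongr
    _ = 1 / 4 * ((S * 8) ^ (1 / 4 : ℝ) * (S' ^ 2) ^ (3 / 4 : ℝ)) * M ^ (1 / 4 : ℝ) := by
        rw [← mul_assoc S, Real.mul_rpow (by positivity) hM0]; ring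
    _ ≤ _ := by
        rw [add_mul, one_mul]
        exact le_add_of_nonneg_right (by positivity)

end DiscrepancyBound

/-! ### Discarding the exceptional exponents -/

section AlmostAllExponents

open Finset

theorem log_log_floor_le {p : ℕ} (hp : 2 ≤ p) (h : 1 ≤ Real.log (Real.log p)) :
    ((Nat.log 2 (Nat.log 2 p) + 1 : ℕ) : ℝ) ≤ 4 * Real.log (Real.log p) := by
  have hl2 : 1 / 2 < Real.log 2 := by have := Real.log_two_gt_d9; linarith
  have hl2' : Real.log 2 < 1 := by have := Real.log_two_lt_d9; linarith
  have hpow : ∀ m : ℕ, m ≠ 0 → (Nat.log 2 m : ℝ) * Real.log 2 ≤ Real.log m := fun m hm => by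
    rw [← Real.log_pow]
    refine Real.log_le_log (by positivity) ?_
    exact_mod_cast Nat.pow_log_le_self 2 hm
  have h0 : Nat.log 2 p ≠ 0 := (Nat.log_pos (by norm_num) hp).ne'
  have h1 := hpow p (by omega)
  have h2 := hpow _ h0
  have hL0 : (0 : ℝ) < Nat.log 2 p := by exact_mod_cast Nat.pos_of_ne_zero h0
  have hlogp : 0 < Real.log p := Real.log_pos (by exact_mod_cast hp)
  have h3 : Real.log (Nat.log 2 p) ≤ Real.log (Real.log p) + Real.log 2 := by
    rw [← Real.log_mul hlogp.ne' two_ne_zero]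
    refine Real.log_le_log hL0 ?_
    nlinarith
  push_cast
  nlinarith [Nat.cast_nonneg (α := ℝ) (Nat.log 2 (Nat.log 2 p))]

theorem le_card_powerExponents {p : ℕ} (hp : 4 ≤ p) (h : 1 ≤ Real.log (Real.log p)) :
    (p : ℝ) ≤ 64 * Real.exp 5 * Real.log (Real.log p) ^ 2 * #(powerExponents p) := by
  set J := Nat.log 2 (Nat.log 2 p) + 1 with hJ
  have hpJ : p - 1 ≤ 2 ^ 2 ^ J := by
    have h1 : p < 2 ^ (Nat.log 2 p + 1) := Nat.lt_pow_succ_log_self (by norm_num) p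
    have h2 : Nat.log 2 p < 2 ^ J := Nat.lt_pow_succ_log_self (by norm_num) _
    have h3 : 2 ^ (Nat.log 2 p + 1) ≤ 2 ^ 2 ^ J := Nat.pow_le_pow_right (by norm_num) h2
    omega
  have h1 := le_exp_mul_totient (n := p - 1) (J := J) (by omega) (by omega) hpJ
  have h2 := totient_le_card_powerExponents_add_one (p := p) (by omega)
  -- As φ(p - 1) ≥ 2, removing k = 1 costs at most a factor 2.
  have h3 : (p - 1).totient ≠ 1 := by rw [Ne, Nat.totient_eq_one_iff]; omega
  have h4 : 0 < (p - 1).totient := Nat.totient_pos.mpr (by omega)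
  have h5 : (p - 1).totient ≤ 2 * #(powerExponents p) := by omega
  have h6 : p ≤ 2 * (p - 1) := by omega
  have hJle : (J : ℝ) ≤ 4 * Real.log (Real.log p) := log_log_floor_le (by omega) h
  have h5' : ((p - 1).totient : ℝ) ≤ 2 * #(powerExponents p) := by exact_mod_cast h5
  calc (p : ℝ) ≤ 2 * ((p - 1 : ℕ) : ℝ) := by exact_mod_cast h6
    _ ≤ 2 * (Real.exp 5 * (J : ℝ) ^ 2 * (p - 1).totient) := by gcongr
    _ ≤ 2 * (Real.exp 5 * (4 * Real.log (Real.log p)) ^ 2 * (2 * #(powerExponents p))) := by gcongr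
    _ = _ := by ring

/-- Markov's inequality. -/
theorem card_many_coincidences_le {C : ℝ} {p : ℕ} [Fact p.Prime] {l : ℝ}
    (h : ∑ k ∈ powerExponents p, (#(coincidences p k) : ℝ) ≤ C * (p : ℝ) ^ (8 / 3 : ℝ)) :
    (#{k ∈ powerExponents p | (p : ℝ) ^ (5 / 3 : ℝ) * l ^ 4 < #(coincidences p k)} : ℝ) * l ^ 4
      ≤ C * p := by
  have hp0 : (0 : ℝ) < p := by exact_mod_cast (Fact.out : p.Prime).pos
  set E : Finset ℕ := {k ∈ powerExponents p | (p : ℝ) ^ (5 / 3 : ℝ) * l ^ 4 < #(coincidences p k)}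
  have h1 : (#E : ℝ) * ((p : ℝ) ^ (5 / 3 : ℝ) * l ^ 4) ≤ C * (p : ℝ) ^ (8 / 3 : ℝ) := by
    refine le_trans ?_ h
    rw [← nsmul_eq_mul, ← sum_const]
    calc _ ≤ ∑ k ∈ E, (#(coincidences p k) : ℝ) :=
          sum_le_sum fun k hk => (mem_filter.mp hk).2.le
      _ ≤ _ := sum_le_sum_of_subset_of_nonneg (filter_subset _ _) fun k _ _ => by positivity
  rw [show (8 / 3 : ℝ) = 1 + 5 / 3 by norm_num, Real.rpow_add hp0, Real.rpow_one] at h1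
  have h2 : (0 : ℝ) < (p : ℝ) ^ (5 / 3 : ℝ) := by positivity
  refine le_of_mul_le_mul_right ?_ h2
  calc _ = (#E : ℝ) * ((p : ℝ) ^ (5 / 3 : ℝ) * l ^ 4) := by ring
    _ ≤ _ := h1
    _ = _ := by ring

/-- The exponent is (2 + 5/3)/4 = 11/12, and the threshold carries l⁴ so that its fourth root is l.
-/
theorem fourth_root_le {p T l : ℝ} (hp : 1 ≤ p) (hl : 1 ≤ l)
    (hT : T ≤ p ^ (5 / 3 : ℝ) * l ^ 4) (hT0 : 0 ≤ T) :
    (p + p ^ 2 * T) ^ (1 / 4 : ℝ) ≤ 2 * (p ^ (11 / 12 : ℝ) * l) := by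
  have hp0 : 0 < p := by linarith
  have hl4 : 1 ≤ l ^ 4 := one_le_pow₀ hl
  have e1 : p ^ 2 * p ^ (5 / 3 : ℝ) = p ^ (11 / 3 : ℝ) := by
    rw [← Real.rpow_natCast, ← Real.rpow_add hp0]; norm_num
  have e2 : (p ^ (11 / 12 : ℝ)) ^ 4 = p ^ (11 / 3 : ℝ) := by
    rw [← Real.rpow_natCast, ← Real.rpow_mul hp0.le]; norm_num
  have h1 : p ≤ p ^ (11 / 3 : ℝ) * l ^ 4 := by
    calc p = p ^ (1 : ℝ) * 1 := by rw [Real.rpow_one, mul_one]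
      _ ≤ p ^ (11 / 3 : ℝ) * l ^ 4 := by
          gcongr
          norm_num
  have h2 : p ^ 2 * T ≤ p ^ (11 / 3 : ℝ) * l ^ 4 := by
    rw [← e1, mul_assoc]; gcongr
  have h3 : p + p ^ 2 * T ≤ (2 * (p ^ (11 / 12 : ℝ) * l)) ^ 4 := by
    rw [mul_pow, mul_pow, e2]
    have : 0 ≤ p ^ (11 / 3 : ℝ) * l ^ 4 := by positivity
    linarith
  calc (p + p ^ 2 * T) ^ (1 / 4 : ℝ) ≤ ((2 * (p ^ (11 / 12 : ℝ) * l)) ^ 4) ^ (1 / 4 : ℝ) := by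
        gcongr
    _ = _ := by
        rw [← Real.rpow_natCast, ← Real.rpow_mul (by positivity)]; norm_num

end AlmostAllExponents

theorem mainTheorem5 :
    ∃ C : ℝ, 0 < C ∧ ∀ ε : ℝ, 0 < ε → ∃ p₀ : ℕ, ∀ (p : ℕ) [Fact p.Prime], p₀ ≤ p →
      ({k : powerExponents p | ¬ ∀ a : (ZMod p)ˣ,
          permDiscrepancy (powerPerm p a k) ≤
            C * ((p : ℝ) ^ (11 / 12 : ℝ) * Real.log (Real.log (p : ℝ)))}.ncard : ℝ)
        ≤ ε * ((powerExponents p).card : ℝ) := by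
  obtain ⟨C₀, hC₀, hdisc⟩ := exists_permDiscrepancy_le
  obtain ⟨C₁, hC₁, hcoin⟩ := exists_sum_card_coincidences_le
  refine ⟨C₀ * 2, by positivity, fun ε hε => ?_⟩
  have htend : Filter.Tendsto (fun p : ℕ => Real.log (Real.log (p : ℝ))) Filter.atTop Filter.atTop :=
    Real.tendsto_log_atTop.comp (Real.tendsto_log_atTop.comp tendsto_natCast_atTop_atTop)
  -- The exceptional proportion is at most 64 e⁵ C₁ / l², hence at most ε under these two lower
  -- bounds on l.
  obtain ⟨p₁, hp₁⟩ := Filter.eventually_atTop.mp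
    (htend.eventually_ge_atTop (max 1 (64 * Real.exp 5 * C₁ / ε)))
  refine ⟨max p₁ 4, fun p _ hp => ?_⟩
  have hp4 : 4 ≤ p := (le_max_right _ _).trans hp
  have hlbig := hp₁ p ((le_max_left _ _).trans hp)
  set l := Real.log (Real.log (p : ℝ)) with hl
  have hl1 : 1 ≤ l := (le_max_left _ _).trans hlbig
  have hlε : 64 * Real.exp 5 * C₁ / ε ≤ l := (le_max_right _ _).trans hlbig
  have hl0 : 0 < l := by linarith
  have hbad : ({k : powerExponents p | ¬ ∀ a : (ZMod p)ˣ, permDiscrepancy (powerPerm p a k) ≤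
      C₀ * 2 * ((p : ℝ) ^ (11 / 12 : ℝ) * l)}).ncard ≤ ((powerExponents p).filter
        fun k => (p : ℝ) ^ (5 / 3 : ℝ) * l ^ 4 < (coincidences p k).card).card := by
    rw [← Set.ncard_image_of_injective _ Subtype.val_injective, ← Set.ncard_coe_finset]
    refine Set.ncard_le_ncard ?_ (Finset.finite_toSet _)
    rintro _ ⟨k, hk, rfl⟩
    rw [Finset.mem_coe, Finset.mem_filter]
    refine ⟨k.2, ?_⟩
    by_contra hle
    refine hk fun a => (hdisc p (by omega) a k).trans ?_
    rw [mul_assoc]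
    exact mul_le_mul_of_nonneg_left (fourth_root_le (by exact_mod_cast (by omega : 1 ≤ p)) hl1
      (not_lt.mp hle) (Nat.cast_nonneg _)) hC₀.le
  have hcard := card_many_coincidences_le (l := l) (hcoin p (by omega))
  have hK := le_card_powerExponents hp4 hl1
  set b := ((powerExponents p).filter
    fun k => (p : ℝ) ^ (5 / 3 : ℝ) * l ^ 4 < (coincidences p k).card).card
  refine (Nat.cast_le.mpr hbad).trans ?_
  rw [div_le_iff₀ hε] at hlε
  refine le_of_mul_le_mul_right ?_ (pow_pos hl0 4)
  have hK0 : (0 : ℝ) ≤ (powerExponents p).card := Nat.cast_nonneg _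
  calc (b : ℝ) * l ^ 4 ≤ C₁ * p := hcard
    _ ≤ C₁ * (64 * Real.exp 5 * l ^ 2 * (powerExponents p).card) := by gcongr
    _ = (64 * Real.exp 5 * C₁) * (l ^ 2 * (powerExponents p).card) := by ring
    _ ≤ (l * ε) * (l ^ 2 * (powerExponents p).card) := by gcongr
    _ = ε * (powerExponents p).card * l ^ 3 := by ring
    _ ≤ ε * (powerExponents p).card * l ^ 4 := by
        gcongr
        norm_num
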